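/- **Theorem.** Let $M$ be a closed (compact, without boundary) smooth three-manifold, let $\kappa\in\mathbb R$, and let $(g,\phi)$ be a Heterotic soliton with vanishing torsion on $M$, that is, a smooth Riemannian metric $g$ and a function $\phi\in C^\infty(M)$ (the dilaton) with $$\mathrm{Ric}^g+\nabla^g\mathrm d\phi-\tfrac12 e^{2\phi}g+\kappa\,\mathcal R^g\circ_g\mathcal R^g=0,\qquad \mathrm d_{\nabla^g}^*\mathcal R^g+\mathcal R^g(\mathrm d\phi)=0,\qquad \delta^g\mathrm d\phi+|\mathrm d\phi|_g^2-e^{2\phi}+\kappa|\mathcal R^g|_g^2=0 .$$ Here $\nabla^g$ is the Levi-Civita connection, $\mathcal R^g_{u,v}w=\nabla_u\nabla_vw-\nabla_v\nabla_uw-\nabla_{[u,v]}w$ is regarded as the four-tensor $\mathcal R^g(u,v,w,z)=g(\mathcal R^g_{u,v}w,z)$, and, for any local orthonormal frame $(e_i)$, $\mathrm{Ric}^g(u,v)=\sum_i\mathcal R^g(e_i,u,v,e_i)$, $(\mathcal R^g\circ_g\mathcal R^g)(u,v)=\frac12\sum_{i,j,k}\mathcal R^g(u,e_i,e_j,e_k)\,\mathcal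 R^g(v,e_i,e_j,e_k)$, $|\mathcal R^g|^2_g=\frac14\sum_{i,j,k,l}\mathcal R^g(e_i,e_j,e_k,e_l)^2$, $(\mathrm d_{\nabla^g}^*\mathcal R^g)(u,v,w)=-\sum_i(\nabla^g_{e_i}\mathcal R^g)(e_i,u,v,w)$, $\mathcal R^g(\mathrm d\phi)=\mathcal R^g(\operatorname{grad}\phi,\cdot,\cdot,\cdot)$ and $\delta^g\mathrm d\phi=-\operatorname{tr}_g\nabla^g\mathrm d\phi$. Suppose that $g$ is not flat and has harmonic curvature, i.e. $\mathrm d_{\nabla^g}^*\mathcal R^g=0$. Then $\phi$ is constant and $(g,\phi)$ is hyperbolic: $g$ has constant negative sectional curvature (so $\mathrm{Ric}^g=\frac13 s_g\,g$, where $s_g=\operatorname{tr}_g\mathrm{Ric}^g$), with $\kappa s_g=-24$ and $\kappa e^{2\phi}=48$. -/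

import Mathlib

open scoped ContDiff Manifold

noncomputable section

/-!
Riemannian geometry in local coordinates, in dimension three.  Tensor fields are given by their
components in an arbitrary chart of the maximal smooth atlas.
-/

namespace Heterotic

/-- The model space of three-manifolds. -/
abbrev E3 : Type := EuclideanSpace ℝ (Fin 3)

/-! ### Tensor calculus on an open subset of `ℝ³`

`G` is the matrix of components of a metric in the coordinates and `f` is a function of the
coordinates. -/

/-- The partial derivative `∂ᵢ f`. -/
def pd (i : Fin 3) (f : E3 → ℝ) (y : E3) : ℝ :=
  fderiv ℝ f y (EuclideanSpace.single i 1)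

/-- The components `gⁱʲ` of the inverse metric. -/
def ginv (G : E3 → Matrix (Fin 3) (Fin 3) ℝ) (y : E3) (i j : Fin 3) : ℝ :=
  (G y)⁻¹ i j

/-- The Christoffel symbols of the Levi-Civita connection, `∇_{∂ᵢ} ∂ⱼ = ∑ k, Γᵏᵢⱼ ∂ₖ`:
`christoffel G k i j = Γᵏᵢⱼ = ½ ∑ l, gᵏˡ (∂ᵢ gⱼₗ + ∂ⱼ gᵢₗ - ∂ₗ gᵢⱼ)`. -/
def christoffel (G : E3 → Matrix (Fin 3) (Fin 3) ℝ) (k i j : Fin 3) (y : E3) : ℝ :=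
  (1 / 2) * ∑ l, ginv G y k l *
    (pd i (fun z => G z j l) y + pd j (fun z => G z i l) y - pd l (fun z => G z i j) y)

/-- The components of `R(∂ᵢ, ∂ⱼ) ∂ₖ = ∑ m, (riemUp G i j k m) ∂ₘ`, where
`R(X, Y) Z = ∇_X ∇_Y Z - ∇_Y ∇_X Z - ∇_{[X, Y]} Z`. -/
def riemUp (G : E3 → Matrix (Fin 3) (Fin 3) ℝ) (i j k m : Fin 3) (y : E3) : ℝ :=
  pd i (christoffel G m j k) y - pd j (christoffel G m i k) y +
    ∑ p, (christoffel G m i p y * christoffel G p j k y -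
      christoffel G m j p y * christoffel G p i k y)

/-- The Riemann tensor as a section of `Ω² ⊗ Ω²`: `riem G i j k l = g(R(∂ᵢ, ∂ⱼ) ∂ₖ, ∂ₗ)`. -/
def riem (G : E3 → Matrix (Fin 3) (Fin 3) ℝ) (i j k l : Fin 3) (y : E3) : ℝ :=
  ∑ m, riemUp G i j k m y * G y m l

/-- The Ricci tensor `Ric(v, w) = ∑ a, R(eₐ, v, w, eₐ)`, for an orthonormal frame `eₐ`. -/
def ric (G : E3 → Matrix (Fin 3) (Fin 3) ℝ) (i j : Fin 3) (y : E3) : ℝ :=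
  ∑ a, ∑ b, ginv G y a b * riem G a i j b y

/-- The scalar curvature, the trace of the Ricci tensor. -/
def scal (G : E3 → Matrix (Fin 3) (Fin 3) ℝ) (y : E3) : ℝ :=
  ∑ i, ∑ j, ginv G y i j * ric G i j y

/-- The covariant derivative of the Riemann tensor: `covRiem G p i j k l = (∇_{∂ₚ} R)ᵢⱼₖₗ`. -/
def covRiem (G : E3 → Matrix (Fin 3) (Fin 3) ℝ) (p i j k l : Fin 3) (y : E3) : ℝ :=
  pd p (riem G i j k l) y -
    ∑ q, (christoffel G q p i y * riem G q j k l y + christoffel G q p j y * riem G i q k l y +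
      christoffel G q p k y * riem G i j q l y + christoffel G q p l y * riem G i j k q y)

/-- The codifferential of the curvature, `(d_∇^* R)(u, v, w) = - ∑ a, (∇_{eₐ} R)(eₐ, u, v, w)`
for an orthonormal frame `eₐ`. -/
def codiffRiem (G : E3 → Matrix (Fin 3) (Fin 3) ℝ) (j k l : Fin 3) (y : E3) : ℝ :=
  -∑ a, ∑ b, ginv G y a b * covRiem G a b j k l y

/-- `(R ∘ R)(v, w) = ½ ∑ i j k, R(v, eᵢ, eⱼ, eₖ) R(w, eᵢ, eⱼ, eₖ)`, for an orthonormal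
frame `eᵢ`. -/
def riemSq (G : E3 → Matrix (Fin 3) (Fin 3) ℝ) (a b : Fin 3) (y : E3) : ℝ :=
  (1 / 2) * ∑ i, ∑ i', ∑ j, ∑ j', ∑ k, ∑ k',
    ginv G y i i' * ginv G y j j' * ginv G y k k' * (riem G a i j k y * riem G b i' j' k' y)

/-- `|R|² = ¼ ∑ i j k l, R(eᵢ, eⱼ, eₖ, eₗ)²`, for an orthonormal frame `eᵢ`. -/
def riemNormSq (G : E3 → Matrix (Fin 3) (Fin 3) ℝ) (y : E3) : ℝ :=
  (1 / 4) * ∑ i, ∑ i', ∑ j, ∑ j', ∑ k, ∑ k', ∑ l, ∑ l',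
    ginv G y i i' * ginv G y j j' * ginv G y k k' * ginv G y l l' *
      (riem G i j k l y * riem G i' j' k' l' y)

/-- `|df|²`. -/
def dNormSq (G : E3 → Matrix (Fin 3) (Fin 3) ℝ) (f : E3 → ℝ) (y : E3) : ℝ :=
  ∑ i, ∑ j, ginv G y i j * (pd i f y * pd j f y)

/-- The Hessian `∇df`. -/
def hess (G : E3 → Matrix (Fin 3) (Fin 3) ℝ) (f : E3 → ℝ) (i j : Fin 3) (y : E3) : ℝ :=
  pd i (pd j f) y - ∑ k, christoffel G k i j y * pd k f y

/-- `δdf = - tr ∇df`, with `δ` the formal adjoint of the exterior derivative. -/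
def codiffD (G : E3 → Matrix (Fin 3) (Fin 3) ℝ) (f : E3 → ℝ) (y : E3) : ℝ :=
  -∑ i, ∑ j, ginv G y i j * hess G f i j y

/-- `R(df)`: the contraction of the first slot of the Riemann tensor with the gradient of `f`. -/
def riemD (G : E3 → Matrix (Fin 3) (Fin 3) ℝ) (f : E3 → ℝ) (j k l : Fin 3) (y : E3) : ℝ :=
  ∑ a, ∑ b, ginv G y a b * pd a f y * riem G b j k l y

/-! ### Riemannian three-manifolds -/

variable {M : Type*} [TopologicalSpace M] [ChartedSpace E3 M] [IsManifold 𝓘(ℝ, E3) ∞ M]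

/-- A smooth Riemannian metric on the three-manifold `M`. -/
abbrev Metric (M : Type*) [TopologicalSpace M] [ChartedSpace E3 M]
    [IsManifold 𝓘(ℝ, E3) ∞ M] : Type _ :=
  Bundle.ContMDiffRiemannianMetric 𝓘(ℝ, E3) ∞ E3 (fun x : M => TangentSpace 𝓘(ℝ, E3) x)

/-- The smooth charts of `M`: those of the maximal atlas. -/
abbrev charts (M : Type*) [TopologicalSpace M] [ChartedSpace E3 M] :
    Set (OpenPartialHomeomorph M E3) :=
  IsManifold.maximalAtlas 𝓘(ℝ, E3) ∞ M

/-- The coordinate vector field `∂ᵢ` of the chart `e`, at the point with coordinates `y`. -/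
def coordVec (e : OpenPartialHomeomorph M E3) (y : E3) (i : Fin 3) :
    TangentSpace 𝓘(ℝ, E3) (e.symm y) :=
  mfderiv 𝓘(ℝ, E3) 𝓘(ℝ, E3) e.symm y (EuclideanSpace.single i (1 : ℝ) : E3)

/-- The components `gᵢⱼ = g(∂ᵢ, ∂ⱼ)` of the metric in the chart `e`. -/
def coordMetric (g : Metric M) (e : OpenPartialHomeomorph M E3) (y : E3) :
    Matrix (Fin 3) (Fin 3) ℝ :=
  Matrix.of fun i j => g.inner (e.symm y) (coordVec e y i) (coordVec e y j)

/-- `g` is flat: its Riemann tensor vanishes identically. -/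
def IsFlat (g : Metric M) : Prop :=
  ∀ e ∈ charts M, ∀ y ∈ e.target, ∀ i j k l, riem (coordMetric g e) i j k l y = 0

/-- `g` has harmonic curvature: its Riemann tensor is divergence-free. -/
def HasHarmonicCurvature (g : Metric M) : Prop :=
  ∀ e ∈ charts M, ∀ y ∈ e.target, ∀ j k l, codiffRiem (coordMetric g e) j k l y = 0

/-- `g` has constant sectional curvature `K`:
`g(R(u, v) v, u) = K (|u|² |v|² - g(u, v)²)` for all tangent vectors `u` and `v`. -/
def HasConstantSectionalCurvature (g : Metric M) (K : ℝ) : Prop :=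
  ∀ e ∈ charts M, ∀ y ∈ e.target, ∀ u v : Fin 3 → ℝ,
    ∑ i, ∑ j, ∑ k, ∑ l, riem (coordMetric g e) i j k l y * (u i * v j * v k * u l) =
      K * ((∑ i, ∑ j, coordMetric g e y i j * (u i * u j)) *
        (∑ i, ∑ j, coordMetric g e y i j * (v i * v j)) -
        (∑ i, ∑ j, coordMetric g e y i j * (u i * v j)) ^ 2)

/-- The Heterotic soliton system with vanishing torsion and parameter `κ`, for a Riemannian
metric `g` and a smooth function `φ`, the dilaton. -/
structure IsTorsionlessSoliton (κ : ℝ) (g : Metric M) (φ : M → ℝ) : Prop where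
  smooth : ContMDiff 𝓘(ℝ, E3) 𝓘(ℝ, ℝ) ∞ φ
  /-- `Ric + ∇dφ - ½ e^{2φ} g + κ R ∘ R = 0` -/
  einstein : ∀ e ∈ charts M, ∀ y ∈ e.target, ∀ i j,
    ric (coordMetric g e) i j y + hess (coordMetric g e) (φ ∘ e.symm) i j y
      - (1 / 2) * Real.exp (2 * φ (e.symm y)) * coordMetric g e y i j
      + κ * riemSq (coordMetric g e) i j y = 0
  /-- `d_∇^* R + R(dφ) = 0` -/
  yangMills : ∀ e ∈ charts M, ∀ y ∈ e.target, ∀ j k l,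
    codiffRiem (coordMetric g e) j k l y + riemD (coordMetric g e) (φ ∘ e.symm) j k l y = 0
  /-- `δdφ + |dφ|² - e^{2φ} + κ |R|² = 0` -/
  dilaton : ∀ e ∈ charts M, ∀ y ∈ e.target,
    codiffD (coordMetric g e) (φ ∘ e.symm) y + dNormSq (coordMetric g e) (φ ∘ e.symm) y
      - Real.exp (2 * φ (e.symm y)) + κ * riemNormSq (coordMetric g e) y = 0

/-- A hyperbolic soliton: the dilaton is constant and the metric is a hyperbolic (that is,
constant negative sectional curvature, so Einstein) metric of scalar curvature `s` with
`κ s = -24`, and `κ e^{2φ} = 48`. -/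
structure IsHyperbolicSoliton (κ : ℝ) (g : Metric M) (φ : M → ℝ) : Prop where
  soliton : IsTorsionlessSoliton κ g φ
  constant : ∃ c : ℝ, ∀ x, φ x = c
  hyperbolic : ∃ K : ℝ, K < 0 ∧ HasConstantSectionalCurvature g K
  einstein : ∀ e ∈ charts M, ∀ y ∈ e.target, ∀ i j,
    ric (coordMetric g e) i j y = (1 / 3) * scal (coordMetric g e) y * coordMetric g e y i j
  scalar : ∀ e ∈ charts M, ∀ y ∈ e.target, κ * scal (coordMetric g e) y = -24
  dilaton : ∀ x, κ * Real.exp (2 * φ x) = 48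

end Heterotic

end

/-! The argument is pointwise and local. Write `F = |dφ|²`, `E = e^{2φ}`, let `W = Ric - ½ s g` be
the Einstein tensor and `t = tr W = -s/2`. In dimension three `W` determines the curvature: in an
orthonormal frame `R_{ijkl} = ∑ ε_{ijm} ε_{kln} W_{mn}` (`IsCurvatureLike.eq_ofEinstein`), so the
soliton system becomes algebra in a symmetric 3×3 matrix.

The dilaton is locally constant. Harmonic curvature reduces the Yang–Mills equation to `R(dφ) = 0`.
The Einstein equation evaluated on the gradient then gives `dF = E dφ`, whereas `dE = 2E dφ`. Where
`dφ ≠ 0`, nullity forces `F W = t dφ ⊗ dφ`. Differentiating `R(·,·,·,grad φ) = 0` and taking the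
divergence shows that the curvature contracted with the Hessian vanishes; with the Einstein and
dilaton equations this yields a polynomial relation between `F` and `E` (`nullity_relation`). It has
two factors, and differentiating either one along `dF = E dφ`, `dE = 2E dφ` gives `E = 0`, which is
absurd.

The metric is Einstein. With `dφ = 0` the system reads `κ W² = W + (E/4) g`, `tr W = E/4`, `κ |W|² =
E`, so `κ > 0`. Harmonicity makes `W` a Codazzi tensor, so `∇W` is totally symmetric.
Differentiating the quadratic equation shows that `∇W` anticommutes with `N = W - g/(2κ)`, whose
square is a positive multiple of the identity. Carrying `N` around the three slots of `∇W` changes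
the sign an odd number of times, hence `∇W = 0`. The Ricci identity now makes `W` commute with the
curvature: for eigenvalues `wᵢ` of `W` this says `wᵢ (wⱼ - wₖ) = 0`, and `W` is invertible because
`W (κ W - 1) = E/4`. So `W = w g`, and the trace and quadratic equations give `E = 12 w`, `κ w = 4`.
-/

namespace Heterotic

/-! ### Smoothness and positivity of the metric components in a chart. -/

section Coordinates

theorem bilin_sum_smul {V : Type*} [AddCommGroup V] [Module ℝ V] [TopologicalSpace V]
    (B : V →L[ℝ] V →L[ℝ] ℝ) (x : Fin 3 → ℝ) (c : Fin 3 → V) :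
    B (∑ i, x i • c i) (∑ i, x i • c i) =
      dotProduct (star x) ((Matrix.of fun i j => B (c i) (c j)).mulVec x) := by
  simp only [map_sum, map_smul, sum_apply, smul_apply,
    dotProduct, Matrix.mulVec, Matrix.of_apply, smul_eq_mul, Finset.mul_sum,
    Pi.star_apply, star_trivial]
  rw [Finset.sum_comm]
  refine Finset.sum_congr rfl fun i _ => Finset.sum_congr rfl fun j _ => ?_
  ring

theorem contDiffOn_comp_symm {M : Type*} [TopologicalSpace M] [ChartedSpace E3 M] {φ : M → ℝ} (hφ : ContMDiff 𝓘(ℝ, E3) 𝓘(ℝ, ℝ) ∞ φ)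
    {e : OpenPartialHomeomorph M E3} (he : e ∈ charts M) :
    ContDiffOn ℝ ∞ (φ ∘ e.symm) e.target := by
  rw [← contMDiffOn_iff_contDiffOn]
  exact hφ.comp_contMDiffOn (contMDiffOn_symm_of_mem_maximalAtlas he)

variable {M : Type*} [TopologicalSpace M] [ChartedSpace E3 M] [IsManifold 𝓘(ℝ, E3) ∞ M]

theorem contMDiffOn_coordVec {e : OpenPartialHomeomorph M E3} (he : e ∈ charts M) (i : Fin 3) :
    ContMDiffOn 𝓘(ℝ, E3) (𝓘(ℝ, E3).prod 𝓘(ℝ, E3)) ∞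
      (fun y => Bundle.TotalSpace.mk' E3 (E := fun x : M => TangentSpace 𝓘(ℝ, E3) x)
        (e.symm y) (coordVec e y i)) e.target := by
  have hs : ContMDiffOn 𝓘(ℝ, E3) 𝓘(ℝ, E3) ∞ e.symm e.target :=
    contMDiffOn_symm_of_mem_maximalAtlas he
  have h1 := hs.contMDiffOn_tangentMapWithin (m := ∞) (by simp) e.open_target.uniqueMDiffOn
  have h2 : ContMDiff 𝓘(ℝ, E3) (𝓘(ℝ, E3).prod 𝓘(ℝ, E3)) ∞
      (fun y : E3 => Bundle.TotalSpace.mk' E3 (E := fun x : E3 => TangentSpace 𝓘(ℝ, E3) x)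
        y (EuclideanSpace.single i (1 : ℝ) : E3)) := by
    exact contMDiff_vectorSpace_iff_contDiff (V := fun _ : E3 =>
      (EuclideanSpace.single i (1 : ℝ) : E3)).2 contDiff_const
  have h3 := h1.comp h2.contMDiffOn (s := e.target) (fun y hy => hy)
  refine h3.congr fun y hy => ?_
  simp only [Function.comp, tangentMapWithin, coordVec]
  rw [mfderivWithin_of_isOpen e.open_target hy]

theorem contDiffOn_coordMetric (g : Metric M) {e : OpenPartialHomeomorph M E3}
    (he : e ∈ charts M) (i j : Fin 3) :
    ContDiffOn ℝ ∞ (fun y => coordMetric g e y i j) e.target := by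
  rw [← contMDiffOn_iff_contDiffOn]
  have hs : ContMDiffOn 𝓘(ℝ, E3) 𝓘(ℝ, E3) ∞ e.symm e.target :=
    contMDiffOn_symm_of_mem_maximalAtlas he
  have h := ContMDiffOn.clm_bundle_apply₂ (F₁ := E3) (F₂ := E3)
    (E₁ := fun x : M => TangentSpace 𝓘(ℝ, E3) x) (E₂ := fun x : M => TangentSpace 𝓘(ℝ, E3) x)
    (E₃ := Bundle.Trivial M ℝ) (b := e.symm)
    (g.contMDiff.comp_contMDiffOn hs) (contMDiffOn_coordVec he i) (contMDiffOn_coordVec he j)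
  intro y hy
  have h' := h y hy
  rw [Bundle.contMDiffWithinAt_totalSpace] at h'
  exact h'.2

theorem coordMetric_isSymm (g : Metric M) (e : OpenPartialHomeomorph M E3) (y : E3) :
    (coordMetric g e y).IsSymm :=
  Matrix.IsSymm.ext fun _ _ => g.symm _ _ _

theorem coordMetric_posDef (g : Metric M) {e : OpenPartialHomeomorph M E3} (he : e ∈ charts M)
    {y : E3} (hy : y ∈ e.target) : (coordMetric g e y).PosDef := by
  let D : E3 →L[ℝ] TangentSpace 𝓘(ℝ, E3) (e.symm y) := mfderiv 𝓘(ℝ, E3) 𝓘(ℝ, E3) e.symm y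
  have hinj : Function.Injective D :=
    (OpenPartialHomeomorph.MDifferentiable.symm
      ⟨(contMDiffOn_of_mem_maximalAtlas he).mdifferentiableOn (by simp),
        (contMDiffOn_symm_of_mem_maximalAtlas he).mdifferentiableOn (by simp)⟩).mfderiv_injective hy
  rw [Matrix.posDef_iff_dotProduct_mulVec]
  refine ⟨(Matrix.conjTranspose_eq_transpose_of_trivial _).trans
    (coordMetric_isSymm g e y).eq, fun x hx => ?_⟩
  have hne : D (WithLp.toLp 2 x) ≠ 0 := by
    intro h
    apply hx
    have := hinj (h.trans (map_zero D).symm)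
    simpa using this
  have hsum : (WithLp.toLp 2 x : E3) = ∑ i, x i • (EuclideanSpace.single i (1 : ℝ) : E3) := by
    ext j
    simp [Finset.sum_apply, Pi.single_apply]
  have hpos := g.pos _ _ hne
  have hD : D (WithLp.toLp 2 x) = ∑ i, x i • coordVec e y i := by
    rw [hsum, map_sum]
    exact Finset.sum_congr rfl fun i _ => map_smul D _ _
  rw [hD] at hpos
  rw [bilin_sum_smul] at hpos
  exact hpos

end Coordinates

section Calculus

/-! ### Partial derivatives -/

variable {U : Set E3} {f h : E3 → ℝ} {y : E3}

theorem differentiableAt_of_contDiffOn (hU : IsOpen U) (hf : ContDiffOn ℝ ∞ f U) (hy : y ∈ U) :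
    DifferentiableAt ℝ f y :=
  (hf.contDiffAt (hU.mem_nhds hy)).differentiableAt (by simp)

theorem contDiffOn_pd (hU : IsOpen U) (hf : ContDiffOn ℝ ∞ f U) (i : Fin 3) :
    ContDiffOn ℝ ∞ (pd i f) U :=
  (hf.fderiv_of_isOpen hU (by simp)).clm_apply contDiffOn_const

theorem pd_congr (hU : IsOpen U) (hfh : ∀ z ∈ U, f z = h z) (hy : y ∈ U) (i : Fin 3) :
    pd i f y = pd i h y := by
  have : f =ᶠ[nhds y] h := Filter.eventually_of_mem (hU.mem_nhds hy) hfh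
  rw [pd, this.fderiv_eq, pd]

theorem pd_add (hf : DifferentiableAt ℝ f y) (hh : DifferentiableAt ℝ h y) (i : Fin 3) :
    pd i (fun z => f z + h z) y = pd i f y + pd i h y := by
  simp [pd, fderiv_fun_add hf hh]

theorem pd_sub (hf : DifferentiableAt ℝ f y) (hh : DifferentiableAt ℝ h y) (i : Fin 3) :
    pd i (fun z => f z - h z) y = pd i f y - pd i h y := by
  simp [pd, fderiv_fun_sub hf hh]

theorem pd_mul (hf : DifferentiableAt ℝ f y) (hh : DifferentiableAt ℝ h y) (i : Fin 3) :
    pd i (fun z => f z * h z) y = pd i f y * h y + f y * pd i h y := by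
  simp [pd, fderiv_fun_mul hf hh]; ring

theorem pd_const (c : ℝ) (i : Fin 3) : pd i (fun _ => c) y = 0 := by
  simp [pd]

theorem pd_sum {F : Fin 3 → E3 → ℝ} (hF : ∀ a, DifferentiableAt ℝ (F a) y) (i : Fin 3) :
    pd i (fun z => ∑ a, F a z) y = ∑ a, pd i (F a) y := by
  simp [pd, fderiv_fun_sum fun a _ => hF a]

theorem pd_pd_comm (hU : IsOpen U) (hf : ContDiffOn ℝ ∞ f U) (hy : y ∈ U) (i j : Fin 3) :
    pd i (pd j f) y = pd j (pd i f) y := by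
  have hc := hf.contDiffAt (hU.mem_nhds hy)
  have hd : DifferentiableAt ℝ (fderiv ℝ f) y :=
    (hc.fderiv_right (m := ∞) (by simp)).differentiableAt (by simp)
  have key : ∀ a b : Fin 3, pd a (pd b f) y =
      fderiv ℝ (fderiv ℝ f) y (EuclideanSpace.single a 1) (EuclideanSpace.single b 1) := by
    intro a b
    have : pd b f = fun z => fderiv ℝ f z (EuclideanSpace.single b 1) := rfl
    rw [pd, this, fderiv_clm_apply hd (differentiableAt_const _)]
    simp
  rw [key, key]
  exact (hc.isSymmSndFDerivAt (by simpa using WithTop.coe_le_coe.2 (le_top : (2 : ℕ∞) ≤ ⊤))) _ _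

end Calculus

/-! ### Leibniz rules for matrix-valued functions. -/

section MatrixCalculus

/-- The entrywise partial derivative of a matrix-valued function. -/
noncomputable def mpd (i : Fin 3) (S : E3 → Matrix (Fin 3) (Fin 3) ℝ) (y : E3) : Matrix (Fin 3) (Fin 3) ℝ :=
  Matrix.of fun a b => pd i (fun z => S z a b) y

/-- A matrix-valued function with smooth entries on `U`. -/
def SmoothMat (S : E3 → Matrix (Fin 3) (Fin 3) ℝ) (U : Set E3) : Prop :=
  ∀ a b, ContDiffOn ℝ ∞ (fun z => S z a b) U

variable {U : Set E3} {S T : E3 → Matrix (Fin 3) (Fin 3) ℝ} {y : E3}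

theorem SmoothMat.differentiableAt (hS : SmoothMat S U) (hU : IsOpen U) (hy : y ∈ U)
    (a b : Fin 3) : DifferentiableAt ℝ (fun z => S z a b) y :=
  differentiableAt_of_contDiffOn hU (hS a b) hy

theorem SmoothMat.mpd (hS : SmoothMat S U) (hU : IsOpen U) (i : Fin 3) :
    SmoothMat (mpd i S) U :=
  fun a b => contDiffOn_pd hU (hS a b) i

theorem SmoothMat.mul (hS : SmoothMat S U) (hT : SmoothMat T U) :
    SmoothMat (fun z => S z * T z) U := by
  intro a b
  simp only [Matrix.mul_apply]
  exact ContDiffOn.sum fun c _ => (hS a c).mul (hT c b)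

theorem SmoothMat.transpose (hS : SmoothMat S U) : SmoothMat (fun z => (S z).transpose) U :=
  fun a b => hS b a

theorem SmoothMat.smul {c : E3 → ℝ} (hc : ContDiffOn ℝ ∞ c U) (hS : SmoothMat S U) :
    SmoothMat (fun z => c z • S z) U :=
  fun a b => hc.mul (hS a b)

theorem mpd_congr (hU : IsOpen U) (h : ∀ z ∈ U, S z = T z) (hy : y ∈ U) (i : Fin 3) :
    mpd i S y = mpd i T y := by
  ext a b
  exact pd_congr hU (fun z hz => by rw [h z hz]) hy i

theorem mpd_add (hU : IsOpen U) (hS : SmoothMat S U) (hT : SmoothMat T U) (hy : y ∈ U)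
    (i : Fin 3) : mpd i (fun z => S z + T z) y = mpd i S y + mpd i T y := by
  ext a b
  exact pd_add (hS.differentiableAt hU hy a b) (hT.differentiableAt hU hy a b) i

theorem mpd_mul (hU : IsOpen U) (hS : SmoothMat S U) (hT : SmoothMat T U) (hy : y ∈ U)
    (i : Fin 3) : mpd i (fun z => S z * T z) y = mpd i S y * T y + S y * mpd i T y := by
  ext a b
  simp only [mpd, Matrix.of_apply, Matrix.add_apply, Matrix.mul_apply]
  rw [pd_sum (F := fun c z => S z a c * T z c b) fun c =>
      (hS.differentiableAt hU hy a c).mul (hT.differentiableAt hU hy c b),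
    ← Finset.sum_add_distrib]
  exact Finset.sum_congr rfl fun c _ =>
    pd_mul (hS.differentiableAt hU hy a c) (hT.differentiableAt hU hy c b) i

theorem mpd_smul {c : E3 → ℝ} (hU : IsOpen U) (hc : ContDiffOn ℝ ∞ c U) (hS : SmoothMat S U)
    (hy : y ∈ U) (i : Fin 3) :
    mpd i (fun z => c z • S z) y = pd i c y • S y + c y • mpd i S y := by
  ext a b
  exact pd_mul (differentiableAt_of_contDiffOn hU hc hy) (hS.differentiableAt hU hy a b) i

theorem mpd_const (C : Matrix (Fin 3) (Fin 3) ℝ) (i : Fin 3) : mpd i (fun _ => C) y = 0 := by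
  ext a b
  exact pd_const _ i

theorem mpd_transpose (i : Fin 3) :
    mpd i (fun z => (S z).transpose) y = (mpd i S y).transpose := rfl

theorem mpd_mpd_comm (hU : IsOpen U) (hS : SmoothMat S U) (hy : y ∈ U) (i j : Fin 3) :
    mpd i (mpd j S) y = mpd j (mpd i S) y := by
  ext a b
  exact pd_pd_comm hU (hS a b) hy i j

end MatrixCalculus

/-! ### The Levi-Civita connection and its curvature as matrices. -/

section LeviCivita

open Matrix

/-- `G` is the matrix of a smooth Riemannian metric on the open set `U`. -/
structure IsMetricOn (G : E3 → Matrix (Fin 3) (Fin 3) ℝ) (U : Set E3) : Prop where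
  isOpen : IsOpen U
  smooth : SmoothMat G U
  symm : ∀ y ∈ U, (G y)ᵀ = G y
  posDef : ∀ y ∈ U, (G y).PosDef

/-- The connection matrices, `(gam G p y)ᵏⱼ = Γᵏₚⱼ`. -/
noncomputable def gam (G : E3 → Matrix (Fin 3) (Fin 3) ℝ) (p : Fin 3) (y : E3) : Matrix (Fin 3) (Fin 3) ℝ :=
  Matrix.of fun k j => christoffel G k p j y

/-- The curvature matrices, `(curv G i j y)ᵐₖ = Rᵢⱼₖᵐ`. -/
noncomputable def curv (G : E3 → Matrix (Fin 3) (Fin 3) ℝ) (i j : Fin 3) (y : E3) :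
    Matrix (Fin 3) (Fin 3) ℝ :=
  mpd i (gam G j) y - mpd j (gam G i) y + (gam G i y * gam G j y - gam G j y * gam G i y)

variable {G : E3 → Matrix (Fin 3) (Fin 3) ℝ} {U : Set E3} {y : E3}

theorem riemUp_eq_curv (i j k m : Fin 3) : riemUp G i j k m y = curv G i j y m k := by
  simp [riemUp, curv, mpd, gam, Matrix.mul_apply, Finset.sum_sub_distrib]

theorem riem_eq_curv (i j k l : Fin 3) : riem G i j k l y = ((curv G i j y)ᵀ * G y) k l := by
  simp [riem, riemUp_eq_curv, Matrix.mul_apply]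

namespace IsMetricOn

variable (hG : IsMetricOn G U)
include hG

theorem isUnit_det (hy : y ∈ U) : IsUnit (G y).det :=
  (hG.posDef y hy).det_pos.ne'.isUnit

theorem inv_mul (hy : y ∈ U) : (G y)⁻¹ * G y = 1 :=
  Matrix.nonsing_inv_mul _ (hG.isUnit_det hy)

theorem mul_inv (hy : y ∈ U) : G y * (G y)⁻¹ = 1 :=
  Matrix.mul_nonsing_inv _ (hG.isUnit_det hy)

theorem inv_symm (hy : y ∈ U) : ((G y)⁻¹)ᵀ = (G y)⁻¹ := by
  rw [Matrix.transpose_nonsing_inv, hG.symm y hy]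

theorem smooth_inv : SmoothMat (fun z => (G z)⁻¹) U := by
  have hdet : ContDiffOn ℝ ∞ (fun z => (G z).det) U := by
    simp only [Matrix.det_fin_three]
    have := hG.smooth
    unfold SmoothMat at this
    fun_prop (disch := assumption)
  have hdi : ContDiffOn ℝ ∞ (fun z => ((G z).det)⁻¹) U :=
    hdet.inv fun z hz => (hG.posDef z hz).det_pos.ne'
  have hadj : SmoothMat (fun z => (G z).adjugate) U := by
    have := hG.smooth
    unfold SmoothMat at this
    intro a b
    simp only [Matrix.adjugate_fin_three]
    fin_cases a <;> fin_cases b <;> simp <;> fun_prop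
  simp only [Matrix.inv_def, Ring.inverse_eq_inv']
  exact SmoothMat.smul hdi hadj

theorem symm_apply (hy : y ∈ U) (i j : Fin 3) : G y i j = G y j i := by
  conv_lhs => rw [← hG.symm y hy]
  rfl

theorem pd_symm (hy : y ∈ U) (p i j : Fin 3) :
    pd p (fun z => G z i j) y = pd p (fun z => G z j i) y :=
  pd_congr hG.isOpen (fun _ hz => hG.symm_apply hz i j) hy p

theorem smooth_ginv (i j : Fin 3) : ContDiffOn ℝ ∞ (fun z => ginv G z i j) U :=
  hG.smooth_inv i j

theorem smooth_christoffel (k i j : Fin 3) : ContDiffOn ℝ ∞ (christoffel G k i j) U := by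
  refine contDiffOn_const.mul (ContDiffOn.sum fun l _ => (hG.smooth_ginv k l).mul ?_)
  exact ((contDiffOn_pd hG.isOpen (hG.smooth _ _) _).add
    (contDiffOn_pd hG.isOpen (hG.smooth _ _) _)).sub (contDiffOn_pd hG.isOpen (hG.smooth _ _) _)

theorem smooth_gam (p : Fin 3) : SmoothMat (gam G p) U :=
  fun k j => hG.smooth_christoffel k p j

theorem christoffel_symm (hy : y ∈ U) (k i j : Fin 3) :
    christoffel G k i j y = christoffel G k j i y := by
  simp only [christoffel]
  congr 1
  refine Finset.sum_congr rfl fun l _ => ?_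
  rw [hG.pd_symm hy l i j]
  ring

theorem mul_gam_apply (hy : y ∈ U) (p l i : Fin 3) :
    (G y * gam G p y) l i = (1 / 2) * (pd p (fun z => G z i l) y + pd i (fun z => G z p l) y
      - pd l (fun z => G z p i) y) := by
  have h : gam G p y = (G y)⁻¹ * Matrix.of fun l i => (1 / 2) * (pd p (fun z => G z i l) y +
      pd i (fun z => G z p l) y - pd l (fun z => G z p i) y) := by
    ext k i
    simp only [gam, christoffel, Matrix.of_apply, Matrix.mul_apply, Finset.mul_sum, ginv]
    exact Finset.sum_congr rfl fun l _ => by ring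
  rw [h, ← Matrix.mul_assoc, hG.mul_inv hy, Matrix.one_mul]
  rfl

/-- The Levi-Civita connection is metric. -/
theorem mpd_metric (hy : y ∈ U) (p : Fin 3) :
    mpd p G y = (gam G p y)ᵀ * G y + G y * gam G p y := by
  have h : (gam G p y)ᵀ * G y = (G y * gam G p y)ᵀ := by
    rw [Matrix.transpose_mul, hG.symm y hy]
  rw [h]
  ext i j
  rw [Matrix.add_apply, Matrix.transpose_apply, hG.mul_gam_apply hy, hG.mul_gam_apply hy,
    hG.pd_symm hy p j i]
  simp only [mpd, Matrix.of_apply]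
  ring

theorem mpd_inv (hy : y ∈ U) (p : Fin 3) :
    mpd p (fun z => (G z)⁻¹) y = -(gam G p y * (G y)⁻¹ + (G y)⁻¹ * (gam G p y)ᵀ) := by
  have h1 : mpd p (fun z => (G z)⁻¹ * G z) y = 0 := by
    rw [mpd_congr hG.isOpen (fun z hz => hG.inv_mul hz) hy, mpd_const]
  rw [mpd_mul hG.isOpen hG.smooth_inv hG.smooth hy, hG.mpd_metric hy] at h1
  have h2 := congrArg (· * (G y)⁻¹) h1
  simp only [add_mul, mul_add, zero_mul, Matrix.mul_assoc, hG.mul_inv hy, Matrix.mul_one] at h2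
  rw [← Matrix.mul_assoc (G y)⁻¹ (G y), hG.inv_mul hy, Matrix.one_mul] at h2
  rw [eq_neg_iff_add_eq_zero, ← h2]
  abel

theorem smooth_curv (i j : Fin 3) : SmoothMat (curv G i j) U := by
  intro a b
  have h1 := (hG.smooth_gam j).mpd hG.isOpen i a b
  have h2 := (hG.smooth_gam i).mpd hG.isOpen j a b
  have h3 := (hG.smooth_gam i).mul (hG.smooth_gam j) a b
  have h4 := (hG.smooth_gam j).mul (hG.smooth_gam i) a b
  exact (h1.sub h2).add (h3.sub h4)

/-- The Ricci identity for a parallel field of bilinear forms. -/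
theorem curv_comm_of_parallel {S : E3 → Matrix (Fin 3) (Fin 3) ℝ} (hS : SmoothMat S U)
    (hpar : ∀ z ∈ U, ∀ p, mpd p S z = (gam G p z)ᵀ * S z + S z * gam G p z) (hy : y ∈ U)
    (i j : Fin 3) : (curv G i j y)ᵀ * S y + S y * curv G i j y = 0 := by
  -- Parallelism makes the second partials of `S` algebraic in `S`, the connection matrices and
  -- their derivatives. Antisymmetrised in `i, j` they leave exactly the curvature terms, so the
  -- claim is the symmetry of second partials.
  have key : ∀ i j : Fin 3, mpd i (mpd j S) y =
      ((mpd i (gam G j) y)ᵀ * S y + (gam G j y)ᵀ * ((gam G i y)ᵀ * S y + S y * gam G i y)) +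
      (((gam G i y)ᵀ * S y + S y * gam G i y) * gam G j y + S y * mpd i (gam G j) y) := by
    intro i j
    have hg := hG.smooth_gam j
    rw [mpd_congr hG.isOpen (fun z hz => hpar z hz j) hy,
      mpd_add hG.isOpen (hg.transpose.mul hS) (hS.mul hg) hy,
      mpd_mul hG.isOpen hg.transpose hS hy, mpd_mul hG.isOpen hS hg hy, mpd_transpose,
      hpar y hy i]
  have hc := mpd_mpd_comm hG.isOpen hS hy i j
  rw [key, key, ← sub_eq_zero] at hc
  rw [← hc]
  simp only [curv, Matrix.transpose_add, Matrix.transpose_sub, Matrix.transpose_mul]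
  noncomm_ring

end IsMetricOn

end LeviCivita

/-- The algebraic symmetries of a curvature tensor. -/
structure IsCurvatureLike (R : Fin 3 → Fin 3 → Fin 3 → Fin 3 → ℝ) : Prop where
  antisymm_left : ∀ i j k l, R i j k l = -R j i k l
  antisymm_right : ∀ i j k l, R i j k l = -R i j l k
  bianchi : ∀ i j k l, R i j k l + R j k i l + R k i j l = 0

/-- The classical octahedron argument: four Bianchi identities combined, everything else cancelling
by skew-symmetry. -/
theorem IsCurvatureLike.pair_symm {R : Fin 3 → Fin 3 → Fin 3 → Fin 3 → ℝ}
    (hR : IsCurvatureLike R) (i j k l : Fin 3) : R i j k l = R k l i j := by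
  linarith [hR.bianchi i j k l, hR.bianchi j k l i, hR.bianchi k l i j, hR.bianchi l i j k,
    hR.antisymm_left i j l k, hR.antisymm_left i k j l, hR.antisymm_left j k i l,
    hR.antisymm_left j l k i, hR.antisymm_left k l i j, hR.antisymm_left l i j k,
    hR.antisymm_right i j k l, hR.antisymm_right j k i l, hR.antisymm_right k i j l,
    hR.antisymm_right k l i j, hR.antisymm_right l i j k, hR.antisymm_right j l i k,
    hR.antisymm_right l j i k, hR.antisymm_right i k l j, hR.antisymm_left l j k i,
    hR.antisymm_right l j k i, hR.antisymm_left i k l j, hR.antisymm_left k i l j]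

/-! ### Symmetries of the curvature, gradient and Hessian in coordinates. -/

section Tensors

open Matrix

/-- The components of the gradient of `f`. -/
noncomputable def grad (G : E3 → Matrix (Fin 3) (Fin 3) ℝ) (f : E3 → ℝ) (b : Fin 3) (y : E3) : ℝ :=
  ∑ a, ginv G y b a * pd a f y

variable {G : E3 → Matrix (Fin 3) (Fin 3) ℝ} {U : Set E3} {y : E3} {f : E3 → ℝ}

theorem dNormSq_eq_grad : dNormSq G f y = ∑ i, grad G f i y * pd i f y := by
  simp only [dNormSq, grad, Finset.sum_mul]
  exact Finset.sum_congr rfl fun i _ => Finset.sum_congr rfl fun j _ => by ring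

namespace IsMetricOn

variable (hG : IsMetricOn G U)
include hG

theorem isCurvatureLike (hy : y ∈ U) : IsCurvatureLike fun i j k l => riem G i j k l y where
  antisymm_left i j k l := by
    have h : curv G i j y = -curv G j i y := by simp only [curv]; abel
    simp only [riem_eq_curv, h, Matrix.transpose_neg, Matrix.neg_mul, Matrix.neg_apply]
  antisymm_right i j k l := by
    -- The metric is itself parallel, and the Ricci identity for it is skewness in the last two
    -- slots.
    have h := hG.curv_comm_of_parallel hG.smooth (fun z hz p => hG.mpd_metric hz p) hy i j
    have h2 : G y * curv G i j y = ((curv G i j y)ᵀ * G y)ᵀ := by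
      rw [Matrix.transpose_mul, hG.symm y hy, Matrix.transpose_transpose]
    rw [h2] at h
    have h3 := congrFun (congrFun h k) l
    simp only [Matrix.add_apply, Matrix.transpose_apply _ k l, Matrix.zero_apply] at h3
    simp only [riem_eq_curv]
    linarith
  bianchi i j k l := by
    have h : ∀ m, riemUp G i j k m y + riemUp G j k i m y + riemUp G k i j m y = 0 := by
      intro m
      have hp : ∀ a b c, pd a (christoffel G m b c) y = pd a (christoffel G m c b) y :=
        fun a b c => pd_congr hG.isOpen (fun z hz => hG.christoffel_symm hz m b c) hy a
      simp only [riemUp]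
      rw [hp i j k, hp j i k, hp k i j]
      simp only [Finset.sum_sub_distrib]
      have hc : ∀ a b c, ∑ p, christoffel G m a p y * christoffel G p b c y =
          ∑ p, christoffel G m a p y * christoffel G p c b y := fun a b c =>
        Finset.sum_congr rfl fun p _ => by rw [hG.christoffel_symm hy p b c]
      rw [hc i j k, hc j i k, hc k i j]
      ring
    simp only [riem, ← Finset.sum_add_distrib, ← add_mul, h, zero_mul, Finset.sum_const_zero]

theorem smooth_riem (i j k l : Fin 3) : ContDiffOn ℝ ∞ (riem G i j k l) U := by
  have h : riem G i j k l = fun z => ((curv G i j z)ᵀ * G z) k l := by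
    funext z; exact riem_eq_curv i j k l
  rw [h]
  exact ((hG.smooth_curv i j).transpose.mul hG.smooth) k l

theorem smooth_grad (hf : ContDiffOn ℝ ∞ f U) (b : Fin 3) : ContDiffOn ℝ ∞ (grad G f b) U :=
  ContDiffOn.sum fun a _ => (hG.smooth_ginv b a).mul (contDiffOn_pd hG.isOpen hf a)

theorem pd_ginv (hy : y ∈ U) (p i j : Fin 3) : pd p (fun z => ginv G z i j) y =
    -∑ q, (christoffel G i p q y * ginv G y q j + ginv G y i q * christoffel G j p q y) := by
  have h := congrFun (congrFun (hG.mpd_inv hy p) i) j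
  simpa only [mpd, gam, Matrix.of_apply, Matrix.neg_apply, Matrix.add_apply, Matrix.mul_apply,
    Matrix.transpose_apply, ← Finset.sum_add_distrib, ginv] using h

theorem pd_grad (hf : ContDiffOn ℝ ∞ f U) (hy : y ∈ U) (p b : Fin 3) :
    pd p (grad G f b) y = ∑ a, ginv G y b a * hess G f p a y -
      ∑ c, christoffel G b p c y * grad G f c y := by
  have hd : ∀ a, DifferentiableAt ℝ (fun z => ginv G z b a) y := fun a =>
    differentiableAt_of_contDiffOn hG.isOpen (hG.smooth_ginv b a) hy
  have hd' : ∀ a, DifferentiableAt ℝ (pd a f) y := fun a =>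
    differentiableAt_of_contDiffOn hG.isOpen (contDiffOn_pd hG.isOpen hf a) hy
  have h : pd p (grad G f b) y =
      ∑ a, (pd p (fun z => ginv G z b a) y * pd a f y + ginv G y b a * pd p (pd a f) y) := by
    refine (pd_sum (F := fun a z => ginv G z b a * pd a f z) (fun a => (hd a).mul (hd' a)) p).trans
      (Finset.sum_congr rfl fun a _ => pd_mul (hd a) (hd' a) p)
  rw [h]
  simp only [hG.pd_ginv hy, hess, grad, Fin.sum_univ_three]
  ring

theorem metric_grad (hy : y ∈ U) (i : Fin 3) : ∑ j, G y i j * grad G f j y = pd i f y := by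
  have h : (G y *ᵥ ((G y)⁻¹ *ᵥ fun a => pd a f y)) i = pd i f y := by
    rw [Matrix.mulVec_mulVec, hG.mul_inv hy, Matrix.one_mulVec]
  exact h

theorem ginv_symm (hy : y ∈ U) (i j : Fin 3) : ginv G y i j = ginv G y j i := by
  have h := congrFun (congrFun (hG.inv_symm hy) j) i
  exact h

theorem pd_dNormSq (hf : ContDiffOn ℝ ∞ f U) (hy : y ∈ U) (p : Fin 3) :
    pd p (dNormSq G f) y = 2 * ∑ c, hess G f p c y * grad G f c y := by
  have hd : ∀ a, DifferentiableAt ℝ (grad G f a) y := fun a =>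
    differentiableAt_of_contDiffOn hG.isOpen (hG.smooth_grad hf a) hy
  have hd' : ∀ a, DifferentiableAt ℝ (pd a f) y := fun a =>
    differentiableAt_of_contDiffOn hG.isOpen (contDiffOn_pd hG.isOpen hf a) hy
  have h : pd p (dNormSq G f) y =
      ∑ a, (pd p (grad G f a) y * pd a f y + grad G f a y * pd p (pd a f) y) := by
    rw [pd_congr hG.isOpen (fun z _ => dNormSq_eq_grad) hy]
    refine (pd_sum (F := fun a z => grad G f a z * pd a f z) (fun a => (hd a).mul (hd' a)) p).trans
      (Finset.sum_congr rfl fun a _ => pd_mul (hd a) (hd' a) p)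
  have h2 : ∀ a, pd p (pd a f) y = hess G f p a y + ∑ k, christoffel G k p a y * pd k f y :=
    fun a => by simp only [hess]; ring
  have h3 : ∑ b, (∑ a, ginv G y b a * hess G f p a y) * pd b f y =
      ∑ c, hess G f p c y * grad G f c y := by
    simp only [grad, Finset.sum_mul, Finset.mul_sum]
    rw [Finset.sum_comm]
    refine Finset.sum_congr rfl fun i _ => Finset.sum_congr rfl fun j _ => ?_
    rw [hG.ginv_symm hy j i]; ring
  simp only [h, hG.pd_grad hf hy, h2, sub_mul, mul_add, Finset.sum_add_distrib,
    Finset.sum_sub_distrib, h3, two_mul]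
  simp only [Fin.sum_univ_three]
  ring

theorem smooth_dNormSq (hf : ContDiffOn ℝ ∞ f U) : ContDiffOn ℝ ∞ (dNormSq G f) U :=
  ContDiffOn.sum fun i _ => ContDiffOn.sum fun j _ => (hG.smooth_ginv i j).mul
    ((contDiffOn_pd hG.isOpen hf i).mul (contDiffOn_pd hG.isOpen hf j))

theorem riemD_eq_grad (hy : y ∈ U) (j k l : Fin 3) :
    riemD G f j k l y = ∑ b, grad G f b y * riem G b j k l y := by
  simp only [riemD, grad, Finset.sum_mul]
  rw [Finset.sum_comm]
  exact Finset.sum_congr rfl fun i _ => Finset.sum_congr rfl fun j _ => by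
    rw [hG.ginv_symm hy j i]

/-- If the gradient is in the nullity of the curvature and the curvature is divergence-free, then
the curvature contracted with the Hessian vanishes. -/
theorem riem_hess_eq_zero (hf : ContDiffOn ℝ ∞ f U)
    (hR : ∀ z ∈ U, ∀ j k l, ∑ b, riem G j k l b z * grad G f b z = 0)
    (hdiv : ∀ k l b, codiffRiem G k l b y = 0) (hy : y ∈ U) (k l : Fin 3) :
    ∑ a, ∑ a', ginv G y a a' *
      ∑ b, riem G a' k l b y * ∑ c, ginv G y b c * hess G f a c y = 0 := by
  -- Leibniz rule for the derivative of `R(·,·,·,grad f) = 0`; the Christoffel terms of the other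
  -- three slots drop out by `hR`. Tracing over `p, j` turns the right side into the divergence of
  -- `R`.
  have hcov : ∀ p j, ∑ b, riem G j k l b y * ∑ a, ginv G y b a * hess G f p a y =
      -∑ b, covRiem G p j k l b y * grad G f b y := by
    intro p j
    have hd : ∀ b, DifferentiableAt ℝ (riem G j k l b) y := fun b =>
      differentiableAt_of_contDiffOn hG.isOpen (hG.smooth_riem j k l b) hy
    have hd' : ∀ b, DifferentiableAt ℝ (grad G f b) y := fun b =>
      differentiableAt_of_contDiffOn hG.isOpen (hG.smooth_grad hf b) hy
    have h0 : pd p (fun z => ∑ b, riem G j k l b z * grad G f b z) y = 0 := by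
      rw [pd_congr hG.isOpen (fun z hz => hR z hz j k l) hy, pd_const]
    rw [pd_sum (F := fun b z => riem G j k l b z * grad G f b z)
      (fun b => (hd b).mul (hd' b))] at h0
    simp only [pd_mul (hd _) (hd' _), hG.pd_grad hf hy] at h0
    have e1 := fun q => hR y hy q k l
    have e2 := fun q => hR y hy j q l
    have e3 := fun q => hR y hy j k q
    simp only [covRiem, Fin.sum_univ_three] at *
    linear_combination h0 -
      christoffel G 0 p j y * e1 0 - christoffel G 1 p j y * e1 1 - christoffel G 2 p j y * e1 2 -
      christoffel G 0 p k y * e2 0 - christoffel G 1 p k y * e2 1 - christoffel G 2 p k y * e2 2 -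
      christoffel G 0 p l y * e3 0 - christoffel G 1 p l y * e3 1 - christoffel G 2 p l y * e3 2
  simp only [hcov]
  have h := fun b => hdiv k l b
  simp only [codiffRiem, neg_eq_zero] at h
  have h2 : ∑ b, (∑ a, ∑ a', ginv G y a a' * covRiem G a a' k l b y) * grad G f b y = 0 := by
    simp only [h, zero_mul, Finset.sum_const_zero]
  simp only [Fin.sum_univ_three] at h2 ⊢
  linear_combination -h2

end IsMetricOn

end Tensors

/-! ### Passing from coordinates to an orthonormal frame at one point. -/

section Frames

/-- Evaluation of a covector on the frame given by the columns of `A`. -/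
def fr (A : Matrix (Fin 3) (Fin 3) ℝ) (f : Fin 3 → ℝ) (a : Fin 3) : ℝ :=
  ∑ i, A i a * f i

/-- The frame components of a bilinear form. -/
def fr2 (A : Matrix (Fin 3) (Fin 3) ℝ) (F : Fin 3 → Fin 3 → ℝ) (a b : Fin 3) : ℝ :=
  fr A (fun i => fr A (F i) b) a

/-- The frame components of a trilinear form. -/
def fr3 (A : Matrix (Fin 3) (Fin 3) ℝ) (F : Fin 3 → Fin 3 → Fin 3 → ℝ) (a b c : Fin 3) : ℝ :=
  fr A (fun i => fr2 A (F i) b c) a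

/-- The frame components of a quadrilinear form. -/
def fr4 (A : Matrix (Fin 3) (Fin 3) ℝ) (F : Fin 3 → Fin 3 → Fin 3 → Fin 3 → ℝ)
    (a b c d : Fin 3) : ℝ :=
  fr A (fun i => fr3 A (F i) b c d) a

variable {A : Matrix (Fin 3) (Fin 3) ℝ}

theorem fr_add (f g : Fin 3 → ℝ) (a : Fin 3) :
    fr A (fun i => f i + g i) a = fr A f a + fr A g a := by
  simp [fr, mul_add, Finset.sum_add_distrib]

theorem fr_sub (f g : Fin 3 → ℝ) (a : Fin 3) :
    fr A (fun i => f i - g i) a = fr A f a - fr A g a := by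
  simp [fr, mul_sub, Finset.sum_sub_distrib]

theorem fr_neg (f : Fin 3 → ℝ) (a : Fin 3) : fr A (fun i => -f i) a = -fr A f a := by
  simp [fr]

theorem fr_zero (a : Fin 3) : fr A (fun _ => 0) a = 0 := by
  simp [fr]

theorem fr_const_mul (r : ℝ) (f : Fin 3 → ℝ) (a : Fin 3) :
    fr A (fun i => r * f i) a = r * fr A f a := by
  simp only [fr, Finset.mul_sum]
  exact Finset.sum_congr rfl fun i _ => by ring

theorem fr_mul_const (r : ℝ) (f : Fin 3 → ℝ) (a : Fin 3) :
    fr A (fun i => f i * r) a = fr A f a * r := by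
  simp only [fr, Finset.sum_mul]
  exact Finset.sum_congr rfl fun i _ => by ring

theorem fr_sum (F : Fin 3 → Fin 3 → ℝ) (a : Fin 3) :
    fr A (fun i => ∑ c, F c i) a = ∑ c, fr A (F c) a := by
  simp only [fr, Finset.mul_sum]
  exact Finset.sum_comm

theorem fr_comm (F : Fin 3 → Fin 3 → ℝ) (a b : Fin 3) :
    fr A (fun i => fr A (fun j => F i j) b) a = fr A (fun j => fr A (fun i => F i j) a) b := by
  simp only [fr, Finset.mul_sum]
  rw [Finset.sum_comm]
  exact Finset.sum_congr rfl fun i _ => Finset.sum_congr rfl fun j _ => by ring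

theorem fr_rotate (F : Fin 3 → Fin 3 → Fin 3 → ℝ) (a b c : Fin 3) :
    fr A (fun j => fr A (fun k => fr A (fun i => F i j k) a) c) b =
      fr A (fun i => fr A (fun j => fr A (fun k => F i j k) c) b) a := by
  rw [fr_comm (fun i j => fr A (fun k => F i j k) c)]
  congr 1; funext j
  rw [fr_comm]

theorem fr2_mul (f g : Fin 3 → ℝ) (a b : Fin 3) :
    fr2 A (fun i j => f i * g j) a b = fr A f a * fr A g b := by
  simp only [fr2, fr_const_mul, fr_mul_const]

theorem sum_mul_sum_comm (H : Matrix (Fin 3) (Fin 3) ℝ)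
    (Z : Fin 3 → Fin 3 → Fin 3 → ℝ) :
    ∑ i, ∑ i', H i i' * ∑ b, Z i i' b = ∑ b, ∑ i, ∑ i', H i i' * Z i i' b := by
  simp only [Finset.mul_sum]
  rw [Finset.sum_comm_cycle]

theorem IsCurvatureLike.fr4 {R : Fin 3 → Fin 3 → Fin 3 → Fin 3 → ℝ} (hR : IsCurvatureLike R) :
    IsCurvatureLike (fr4 A R) where
  antisymm_left a b c d := by
    have h : ∀ i j k l, R i j k l = -R j i k l := hR.antisymm_left
    simp only [Heterotic.fr4, fr3]
    rw [fr_comm, ← fr_neg]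
    congr 1; funext i
    rw [← fr_neg]
    congr 1; funext j
    simp only [fr2, ← fr_neg, ← h]
  antisymm_right a b c d := by
    simp only [Heterotic.fr4, fr3, fr2, ← fr_neg]
    congr 1; funext i
    congr 1; funext j
    rw [fr_comm]
    simp only [← hR.antisymm_right]
  bianchi a b c d := by
    have e2 : Heterotic.fr4 A R b c a d =
        Heterotic.fr4 A (fun i j k l => R j k i l) a b c d := by
      simp only [Heterotic.fr4, fr3, fr2]
      exact fr_rotate (fun i j k => fr A (fun l => R j k i l) d) a b c
    have e3 : Heterotic.fr4 A R c a b d =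
        Heterotic.fr4 A (fun i j k l => R k i j l) a b c d := by
      simp only [Heterotic.fr4, fr3, fr2]
      exact (fr_rotate (fun k i j => fr A (fun l => R k i j l) d) c a b).symm
    rw [e2, e3]
    simp only [Heterotic.fr4, fr3, fr2, ← fr_add, hR.bianchi, fr_zero]

/-- A frame which is orthonormal for the metric with inverse matrix `H`. -/
structure IsFrame (A G H : Matrix (Fin 3) (Fin 3) ℝ) : Prop where
  inv : A * A.transpose = H
  metric : A.transpose * G * A = 1
  isUnit : IsUnit A.det

-- Factor `G = Bᵀ B` and take `A = B⁻¹`.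
open scoped MatrixOrder in
theorem exists_isFrame {G : Matrix (Fin 3) (Fin 3) ℝ} (hG : G.PosDef) :
    ∃ A, IsFrame A G G⁻¹ := by
  obtain ⟨B, hB, h⟩ := CStarAlgebra.isStrictlyPositive_iff_eq_star_mul_self.mp
    hG.isStrictlyPositive
  have hd : IsUnit B.det := (Matrix.isUnit_iff_isUnit_det B).1 hB
  have hd' : IsUnit B.transpose.det := by rwa [Matrix.det_transpose]
  rw [Matrix.star_eq_conjTranspose, Matrix.conjTranspose_eq_transpose_of_trivial] at h
  refine ⟨B⁻¹, ?_, ?_, ?_⟩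
  · rw [h, Matrix.mul_inv_rev, Matrix.transpose_nonsing_inv]
  · rw [h, Matrix.transpose_nonsing_inv, ← Matrix.mul_assoc, Matrix.nonsing_inv_mul _ hd',
      Matrix.one_mul, Matrix.mul_nonsing_inv _ hd]
  · exact Matrix.isUnit_nonsing_inv_det _ hd

variable {G H : Matrix (Fin 3) (Fin 3) ℝ}

namespace IsFrame

variable (hA : IsFrame A G H)
include hA

/-- This and its multilinear versions carry tensor identities proved in a frame back to coordinates.
-/
theorem fr_injective {f g : Fin 3 → ℝ} (h : ∀ a, fr A f a = fr A g a) : f = g := by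
  have h1 : A.transpose.mulVec f = A.transpose.mulVec g := by
    funext a; exact h a
  have hu : IsUnit A.transpose.det := by rw [Matrix.det_transpose]; exact hA.isUnit
  have h2 := congrArg (A.transpose⁻¹.mulVec) h1
  rwa [Matrix.mulVec_mulVec, Matrix.mulVec_mulVec, Matrix.nonsing_inv_mul _ hu,
    Matrix.one_mulVec, Matrix.one_mulVec] at h2

theorem fr2_injective {F F' : Fin 3 → Fin 3 → ℝ} (h : ∀ a b, fr2 A F a b = fr2 A F' a b) :
    F = F' := by
  have h1 : ∀ b, (fun i => fr A (F i) b) = fun i => fr A (F' i) b :=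
    fun b => hA.fr_injective fun a => h a b
  funext i
  exact hA.fr_injective fun b => congrFun (h1 b) i

theorem fr3_injective {F F' : Fin 3 → Fin 3 → Fin 3 → ℝ}
    (h : ∀ a b c, fr3 A F a b c = fr3 A F' a b c) : F = F' := by
  have h1 : ∀ b c, (fun i => fr2 A (F i) b c) = fun i => fr2 A (F' i) b c :=
    fun b c => hA.fr_injective fun a => h a b c
  funext i
  exact hA.fr2_injective fun b c => congrFun (h1 b c) i

theorem fr4_injective {F F' : Fin 3 → Fin 3 → Fin 3 → Fin 3 → ℝ}
    (h : ∀ a b c d, fr4 A F a b c d = fr4 A F' a b c d) : F = F' := by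
  have h1 : ∀ b c d, (fun i => fr3 A (F i) b c d) = fun i => fr3 A (F' i) b c d :=
    fun b c d => hA.fr_injective fun a => h a b c d
  funext i
  exact hA.fr3_injective fun b c d => congrFun (h1 b c d) i

theorem fr2_metric (a b : Fin 3) : fr2 A (fun i j => G i j) a b = if a = b then 1 else 0 := by
  have h := congrFun (congrFun hA.metric a) b
  rw [Matrix.one_apply] at h
  rw [← h]
  simp only [fr2, fr, Matrix.mul_apply, Matrix.transpose_apply, Finset.mul_sum, Finset.sum_mul]
  rw [Finset.sum_comm]
  exact Finset.sum_congr rfl fun i _ => Finset.sum_congr rfl fun j _ => by ring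

theorem sum_inv (F : Fin 3 → Fin 3 → ℝ) :
    ∑ i, ∑ j, H i j * F i j = ∑ a, fr2 A F a a := by
  simp only [← hA.inv, fr2, fr, Matrix.mul_apply, Matrix.transpose_apply, Finset.mul_sum,
    Finset.sum_mul]
  simp only [Fin.sum_univ_three]
  ring

theorem sum_inv_mul (f g : Fin 3 → ℝ) :
    ∑ i, ∑ j, H i j * (f i * g j) = ∑ a, fr A f a * fr A g a := by
  rw [hA.sum_inv]
  simp only [fr2_mul]

theorem sum_inv_mul₂ (F F' : Fin 3 → Fin 3 → ℝ) :
    ∑ j, ∑ j', ∑ k, ∑ k', H j j' * H k k' * (F j k * F' j' k') =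
      ∑ b, ∑ a, fr2 A F a b * fr2 A F' a b := by
  simp only [mul_assoc, ← Finset.mul_sum, hA.sum_inv_mul, sum_mul_sum_comm]
  rfl

theorem sum_inv_mul₃ (F F' : Fin 3 → Fin 3 → Fin 3 → ℝ) :
    ∑ i, ∑ i', ∑ j, ∑ j', ∑ k, ∑ k',
      H i i' * H j j' * H k k' * (F i j k * F' i' j' k') =
      ∑ c, ∑ b, ∑ a, fr3 A F a b c * fr3 A F' a b c := by
  have h : ∀ i i', ∑ j, ∑ j', ∑ k, ∑ k', H i i' * H j j' * H k k' * (F i j k * F' i' j' k') =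
      H i i' * ∑ c, ∑ b, fr2 A (F i) b c * fr2 A (F' i') b c := by
    intro i i'
    rw [← hA.sum_inv_mul₂]
    simp only [Finset.mul_sum, mul_assoc]
  simp only [h, hA.sum_inv_mul, sum_mul_sum_comm]
  rfl

theorem sum_inv_mul₄ (F F' : Fin 3 → Fin 3 → Fin 3 → Fin 3 → ℝ) :
    ∑ i, ∑ i', ∑ j, ∑ j', ∑ k, ∑ k', ∑ l, ∑ l',
      H i i' * H j j' * H k k' * H l l' * (F i j k l * F' i' j' k' l') =
      ∑ d, ∑ c, ∑ b, ∑ a, fr4 A F a b c d * fr4 A F' a b c d := by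
  have h : ∀ i i', ∑ j, ∑ j', ∑ k, ∑ k', ∑ l, ∑ l',
      H i i' * H j j' * H k k' * H l l' * (F i j k l * F' i' j' k' l') =
      H i i' * ∑ d, ∑ c, ∑ b, fr3 A (F i) b c d * fr3 A (F' i') b c d := by
    intro i i'
    rw [← hA.sum_inv_mul₃]
    simp only [Finset.mul_sum, mul_assoc]
  simp only [h, hA.sum_inv_mul, sum_mul_sum_comm]
  rfl

end IsFrame

end Frames

/-! ### Pointwise algebra of three-dimensional curvature and the nullity relation. -/

section Algebra

/-- The Kronecker delta. -/
def kd (i j : Fin 3) : ℝ := if i = j then 1 else 0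

/-- The algebraic curvature tensor on Euclidean three-space whose Einstein tensor is `W`. -/
def ofEinstein (W : Fin 3 → Fin 3 → ℝ) (i j k l : Fin 3) : ℝ :=
  W i l * kd j k + W j k * kd i l - W i k * kd j l - W j l * kd i k
    - (∑ a, W a a) * (kd i l * kd j k - kd i k * kd j l)

/-- In dimension three the curvature is determined by the Einstein tensor. -/
theorem IsCurvatureLike.eq_ofEinstein {R : Fin 3 → Fin 3 → Fin 3 → Fin 3 → ℝ}
    (hR : IsCurvatureLike R) {W : Fin 3 → Fin 3 → ℝ}
    (hW : ∀ i j, W i j = ∑ a, R a i j a - (1 / 2) * (∑ b, ∑ a, R a b b a) * kd i j)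
    (i j k l : Fin 3) : R i j k l = ofEinstein W i j k l := by
  have hd : ∀ i k l, R i i k l = 0 := fun i k l => by linarith [hR.antisymm_left i i k l]
  have hd' : ∀ i j k, R i j k k = 0 := fun i j k => by linarith [hR.antisymm_right i j k k]
  have a1 : ∀ k l, R 1 0 k l = -R 0 1 k l := hR.antisymm_left 1 0
  have a2 : ∀ k l, R 2 0 k l = -R 0 2 k l := hR.antisymm_left 2 0
  have a3 : ∀ k l, R 2 1 k l = -R 1 2 k l := hR.antisymm_left 2 1
  have b1 : ∀ i j, R i j 1 0 = -R i j 0 1 := fun i j => hR.antisymm_right i j 1 0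
  have b2 : ∀ i j, R i j 2 0 = -R i j 0 2 := fun i j => hR.antisymm_right i j 2 0
  have b3 : ∀ i j, R i j 2 1 = -R i j 1 2 := fun i j => hR.antisymm_right i j 2 1
  have c1 : R 0 2 0 1 = R 0 1 0 2 := hR.pair_symm _ _ _ _
  have c2 : R 1 2 0 1 = R 0 1 1 2 := hR.pair_symm _ _ _ _
  have c3 : R 1 2 0 2 = R 0 2 1 2 := hR.pair_symm _ _ _ _
  have hk : ∀ i j, kd i j = if i = j then 1 else 0 := fun _ _ => rfl
  fin_cases i <;> fin_cases j <;> fin_cases k <;> fin_cases l <;>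
    simp [ofEinstein, hW, hk, Fin.sum_univ_three, hd, hd', a1, a2, a3, b1, b2, b3, c1, c2, c3] <;>
    ring

variable {W : Fin 3 → Fin 3 → ℝ}

/-- Since `tr W = -s/2`, the Ricci tensor `W + ½ s g` is `W - (tr W) g`. -/
theorem ric_ofEinstein (i j : Fin 3) :
    ∑ a, ofEinstein W a i j a = W i j - (∑ a, W a a) * kd i j := by
  fin_cases i <;> fin_cases j <;> simp [ofEinstein, Fin.sum_univ_three, kd] <;> ring

theorem ric_ofEinstein' (i j : Fin 3) :
    ∑ a, ofEinstein W i a a j = W i j - (∑ a, W a a) * kd i j := by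
  fin_cases i <;> fin_cases j <;> simp [ofEinstein, Fin.sum_univ_three, kd] <;> ring

/-- With `R_{ijkl} = ∑ ε_{ijm} ε_{kln} W_{mn}`, the right-hand pair of `ε` contracts to a factor 2
and the left-hand pair to `δδ - δδ`. -/
theorem sq_ofEinstein (hW : ∀ i j, W i j = W j i) (i j : Fin 3) :
    ∑ c, ∑ b, ∑ a, ofEinstein W i a b c * ofEinstein W j a b c =
      2 * ((∑ a, ∑ b, W a b * W a b) * kd i j - ∑ a, W i a * W a j) := by
  have h1 := hW 1 0
  have h2 := hW 2 0
  have h3 := hW 2 1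
  fin_cases i <;> fin_cases j <;>
    simp [ofEinstein, Fin.sum_univ_three, kd, h1, h2, h3] <;> ring

theorem normSq_ofEinstein (hW : ∀ i j, W i j = W j i) :
    ∑ d, ∑ c, ∑ b, ∑ a, ofEinstein W a b c d * ofEinstein W a b c d =
      4 * ∑ a, ∑ b, W a b * W a b := by
  have h : ∀ X : Fin 3 → Fin 3 → Fin 3 → Fin 3 → ℝ, ∑ d, ∑ c, ∑ b, ∑ a, X a b c d =
      ∑ i, ∑ d, ∑ c, ∑ b, X i b c d := by
    intro X
    simp only [Fin.sum_univ_three]; ring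
  rw [h fun a b c d => ofEinstein W a b c d * ofEinstein W a b c d]
  simp only [sq_ofEinstein hW, kd, if_true]
  have h2 : ∀ a i, W i a * W a i = W i a * W i a := fun a i => by rw [hW a i]
  simp only [h2, Fin.sum_univ_three]
  ring

/-- The relation between `|dφ|²` and `e^{2φ}` at a point where the gradient of the dilaton is in the
nullity of the curvature. -/
theorem nullity_relation (hW : ∀ i j, W i j = W j i) {v : Fin 3 → ℝ} {h : Fin 3 → Fin 3 → ℝ}
    {κ E : ℝ} (hv : ∑ i, v i * v i ≠ 0)
    (hRv : ∀ j k l, ∑ i, v i * ofEinstein W i j k l = 0)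
    (hein : ∀ i j, ∑ a, ofEinstein W a i j a + h i j - (1 / 2) * E * kd i j + κ * ((1 / 2) *
      ∑ c, ∑ b, ∑ a, ofEinstein W i a b c * ofEinstein W j a b c) = 0)
    (hdil : -∑ i, h i i + ∑ i, v i * v i - E + κ * ((1 / 4) *
      ∑ d, ∑ c, ∑ b, ∑ a, ofEinstein W a b c d * ofEinstein W a b c d) = 0)
    (hRh : ∀ k l, ∑ j, ∑ b, ofEinstein W j k l b * h j b = 0) :
    (∑ i, v i * v i - 5 / 2 * E) * (2 * (∑ i, v i * v i - E) +
      2 * κ * (∑ i, v i * v i - E) ^ 2 - E) = 0 := by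
  set F := ∑ i, v i * v i with hF
  set t := ∑ a, W a a with ht
  have hFW : ∀ m n, F * W m n = t * (v m * v n) := by
    -- In the `ε` form of the curvature, nullity of `v` says that the cross product of `v` with
    -- every column of `W` vanishes: each column is parallel to `v`.
    have hx : ∀ m j n, v m * W j n = v j * W m n := by
      have s1 := hW 1 0
      have s2 := hW 2 0
      have s3 := hW 2 1
      have a0 := fun j => hRv j 1 2
      have a1 := fun j => hRv j 2 0
      have a2 := fun j => hRv j 0 1
      have a00 := a0 0
      have a01 := a0 1
      have a02 := a0 2
      have a10 := a1 0
      have a11 := a1 1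
      have a12 := a1 2
      have a20 := a2 0
      have a21 := a2 1
      have a22 := a2 2
      simp [ofEinstein, Fin.sum_univ_three, kd, s1, s2, s3] at a00 a01 a02 a10 a11 a12 a20 a21 a22
      intro m j n
      fin_cases m <;> fin_cases j <;> fin_cases n <;> simp [s1, s2, s3] <;> linarith
    intro m n
    have e1 : F * W m n - t * (v m * v n) = ∑ i, (v i * (v i * W m n - v m * W i n) +
        v m * (v i * W n i - v n * W i i)) := by
      rw [hF, ht]
      simp only [Fin.sum_univ_three]
      rw [hW n 0, hW n 1, hW n 2]
      ring
    have e2 : ∀ i, v i * (v i * W m n - v m * W i n) + v m * (v i * W n i - v n * W i i) = 0 := by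
      intro i
      rw [hx i m n, hx i n i]; ring
    simp only [e2, Finset.sum_const_zero] at e1
    linarith
  -- `W` is `t` times the projection onto `v`, so `|W|² = t²` and `W² = t W`; multiplying by `F²`
  -- avoids dividing by `F`.
  have hFN : F * F * (∑ a, ∑ b, W a b * W a b) = F * F * t ^ 2 := by
    have : F * F * (∑ a, ∑ b, W a b * W a b) = ∑ a, ∑ b, (F * W a b) * (F * W a b) := by
      simp only [Finset.mul_sum]
      exact Finset.sum_congr rfl fun i _ => Finset.sum_congr rfl fun j _ => by ring
    rw [this]
    simp only [hFW]
    rw [hF]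
    simp only [Fin.sum_univ_three]
    ring
  have hN : ∑ a, ∑ b, W a b * W a b = t ^ 2 := mul_left_cancel₀ (mul_ne_zero hv hv) hFN
  have hsq : ∀ i j, ∑ a, W i a * W a j = t * W i j := by
    intro i j
    refine mul_left_cancel₀ (mul_ne_zero hv hv) ?_
    have : F * F * (∑ a, W i a * W a j) = ∑ a, (F * W i a) * (F * W a j) := by
      simp only [Finset.mul_sum]
      exact Finset.sum_congr rfl fun i _ => by ring
    rw [this]
    have h2 : F * F * (t * W i j) = F * (t * (F * W i j)) := by ring
    rw [h2]
    simp only [hFW]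
    rw [hF]
    simp only [Fin.sum_univ_three]
    ring
  simp only [ric_ofEinstein, sq_ofEinstein hW, normSq_ofEinstein hW, hN, hsq, ← ht] at hein hdil
  have hh : ∀ i j, h i j = (E / 2 + t - κ * t ^ 2) * kd i j - (1 - κ * t) * W i j := by
    intro i j
    linear_combination hein i j
  have htr : ∑ i, h i i = 3 * (E / 2 + t - κ * t ^ 2) - (1 - κ * t) * t := by
    simp only [Fin.sum_univ_three] at ht
    simp only [hh, kd, if_true, Fin.sum_univ_three]
    linear_combination (1 - κ * t) * ht
  -- The trace over `k = l` of `hRh`: the Ricci tensor is orthogonal to the Hessian.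
  have hric : ∑ j, ∑ b, (W j b - t * kd j b) * h j b = 0 := by
    have e : ∑ k, ∑ j, ∑ b, ofEinstein W j k k b * h j b = 0 := by simp [hRh]
    rw [← e, Finset.sum_comm_cycle, Finset.sum_comm_cycle]
    simp only [← Finset.sum_mul, ric_ofEinstein', ← ht]
  have hprod : t * (E / 2 + t - κ * t ^ 2) = 0 := by
    have e : ∑ j, ∑ b, (W j b - t * kd j b) * h j b =
        (E / 2 + t - κ * t ^ 2) * (t - 3 * t) - (1 - κ * t) * (t ^ 2 - t * t) := by
      have hk : ∑ j, ∑ b, kd j b * kd j b = 3 := by simp [kd]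
      have hk' : ∑ j, ∑ b, W j b * kd j b = t := by simp [kd, ht]
      simp only [hh, Fin.sum_univ_three] at hN hk hk' ⊢
      linear_combination (E / 2 + t - κ * t ^ 2) * (hk' - t * hk) + (1 - κ * t) * t * hk' -
        (1 - κ * t) * hN
    rw [hric] at e
    linarith
  have hFt : F = 5 / 2 * E + 2 * t - 3 * κ * t ^ 2 := by
    linear_combination hdil + htr
  -- If `t = 0` then `F = 5E/2`, the first factor. Otherwise `E = 2κt² - 2t` and `F - E = -t`;
  -- eliminating `t` gives the second factor.
  rcases mul_eq_zero.1 hprod with h0 | h0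
  · rw [hFt, h0]; ring
  · have e : F - E = -t := by rw [hFt]; linear_combination 3 * h0
    rw [e]
    linear_combination (-2 * (F - 5 / 2 * E)) * h0

end Algebra

/-! ### Pointwise algebra of an Einstein tensor commuting with the curvature. -/

section Algebra

variable {W : Fin 3 → Fin 3 → ℝ}

/-- A soliton with constant dilaton whose Einstein tensor commutes with the curvature has constant
curvature. -/
theorem einstein_of_commute (hW : ∀ i j, W i j = W j i) {κ E : ℝ} (hE : 0 < E)
    (hsq : ∀ i j, κ * ∑ a, W i a * W a j = W i j + E / 4 * kd i j)
    (htr : ∑ a, W a a = E / 4)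
    (hcomm : ∀ i j k l, ∑ m, (ofEinstein W i j k m * W m l + W k m * ofEinstein W i j l m) = 0) :
    ∃ w, κ * w = 4 ∧ E = 12 * w ∧ ∀ i j, W i j = w * kd i j := by
  have s1 := hW 1 0
  have s2 := hW 2 0
  have s3 := hW 2 1
  have q : ∀ i j, κ * (W i 0 * W 0 j + W i 1 * W 1 j + W i 2 * W 2 j) =
      W i j + E / 4 * kd i j := fun i j => by
    rw [← hsq]; simp only [Fin.sum_univ_three]
  have q00 := q 0 0
  have q01 := q 0 1
  have q02 := q 0 2
  have q11 := q 1 1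
  have q12 := q 1 2
  have q22 := q 2 2
  simp [kd, s1, s2, s3] at q00 q01 q02 q11 q12 q22
  have c0 := hcomm 1 2
  have c1 := hcomm 2 0
  have c2 := hcomm 0 1
  have d0 := c0 1 2
  have d1 := c1 1 2
  have d2 := c2 1 2
  have e0 := c0 0 1
  have e1 := c1 0 1
  have e2 := c2 0 1
  simp [ofEinstein, kd, Fin.sum_univ_three, s1, s2, s3] at d0 d1 d2 e0 e1 e2
  -- The commutation identities have the form `W x = 0`, with `x` built from off-diagonal entries
  -- and differences of diagonal entries. Applying `κ W - 1`, which inverts `W` up to the factor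
  -- `E/4`, gives `(E/4) x = 0`; this is the source of the coefficients below.
  have hoff : W 0 1 = 0 ∧ W 0 2 = 0 ∧ W 1 2 = 0 ∧ W 0 0 = W 1 1 ∧ W 1 1 = W 2 2 := by
    have hE' : E / 4 ≠ 0 := by positivity
    have z1 : E / 4 * (W 2 2 - W 1 1) = 0 := by
      linear_combination
        (κ * W 0 0 - 1) * d0 +
        (κ * W 0 1) * d1 +
        (κ * W 0 2) * d2 - (W 2 2 - W 1 1) * q00 - (W 0 1) * q01 - (-W 0 2) * q02
    have z2 : E / 4 * W 0 1 = 0 := by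
      linear_combination
        (κ * W 0 1) * d0 +
        (κ * W 1 1 - 1) * d1 +
        (κ * W 1 2) * d2 - (W 2 2 - W 1 1) * q01 - (W 0 1) * q11 - (-W 0 2) * q12
    have z3 : E / 4 * -W 0 2 = 0 := by
      linear_combination
        (κ * W 0 2) * d0 +
        (κ * W 1 2) * d1 +
        (κ * W 2 2 - 1) * d2 - (W 2 2 - W 1 1) * q02 - (W 0 1) * q12 - (-W 0 2) * q22
    have z4 : E / 4 * -W 1 2 = 0 := by
      linear_combination
        (κ * W 0 1) * e0 +
        (κ * W 1 1 - 1) * e1 +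
        (κ * W 1 2) * e2 - (W 0 2) * q01 - (-W 1 2) * q11 - (W 1 1 - W 0 0) * q12
    have z5 : E / 4 * (W 1 1 - W 0 0) = 0 := by
      linear_combination
        (κ * W 0 2) * e0 +
        (κ * W 1 2) * e1 +
        (κ * W 2 2 - 1) * e2 - (W 0 2) * q02 - (-W 1 2) * q12 - (W 1 1 - W 0 0) * q22
    have y1 := (mul_eq_zero.1 z1).resolve_left hE'
    have y2 := (mul_eq_zero.1 z2).resolve_left hE'
    have y3 := (mul_eq_zero.1 z3).resolve_left hE'
    have y4 := (mul_eq_zero.1 z4).resolve_left hE'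
    have y5 := (mul_eq_zero.1 z5).resolve_left hE'
    refine ⟨y2, ?_, ?_, ?_, ?_⟩ <;> linarith
  obtain ⟨o1, o2, o3, o4, o5⟩ := hoff
  rw [o1, o2] at q00
  simp only [Fin.sum_univ_three] at htr
  rw [← o5, ← o4] at htr
  have hw : E = 12 * W 0 0 := by linarith
  have hw0 : W 0 0 ≠ 0 := by intro h; rw [h] at hw; linarith
  refine ⟨W 0 0, ?_, hw, ?_⟩
  · apply mul_right_cancel₀ hw0
    linear_combination q00 + hw / 4
  · intro i j
    fin_cases i <;> fin_cases j <;> simp [kd, s1, s2, s3, o1, o2, o3, o4, o5]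

end Algebra

/-! ### Frame components of the curvature quantities. -/

section FrameCurvature

/-- The Einstein tensor `Ric - ½ s g`. -/
noncomputable def einsteinTensor (G : E3 → Matrix (Fin 3) (Fin 3) ℝ) (y : E3) :
    Matrix (Fin 3) (Fin 3) ℝ :=
  Matrix.of fun i j => ric G i j y - (1 / 2) * scal G y * G y i j

variable {A : Matrix (Fin 3) (Fin 3) ℝ} {G : E3 → Matrix (Fin 3) (Fin 3) ℝ} {U : Set E3} {y : E3}

namespace IsFrame

variable (hA : IsFrame A (G y) (G y)⁻¹)
include hA

theorem fr2_ric (p q : Fin 3) : fr2 A (fun i j => ric G i j y) p q =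
    ∑ c, fr4 A (fun i j k l => riem G i j k l y) c p q c := by
  have h : ∀ i j, ric G i j y = ∑ c, fr2 A (fun a b => riem G a i j b y) c c := fun i j =>
    hA.sum_inv fun a b => riem G a i j b y
  simp only [h, fr2, fr_sum, fr4, fr3]
  exact Finset.sum_congr rfl fun c _ =>
    fr_rotate (fun a i j => fr A (fun b => riem G a i j b y) c) c p q

theorem scal_eq : scal G y = ∑ b, ∑ a, fr4 A (fun i j k l => riem G i j k l y) a b b a := by
  simp only [← hA.fr2_ric]
  exact hA.sum_inv fun i j => ric G i j y

theorem fr2_riemSq (p q : Fin 3) : fr2 A (fun i j => riemSq G i j y) p q =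
    (1 / 2) * ∑ c, ∑ b, ∑ a, fr4 A (fun i j k l => riem G i j k l y) p a b c *
      fr4 A (fun i j k l => riem G i j k l y) q a b c := by
  have h : ∀ i j, riemSq G i j y = (1 / 2) * ∑ c, ∑ b, ∑ a,
      fr3 A (fun a b c => riem G i a b c y) a b c *
        fr3 A (fun a b c => riem G j a b c y) a b c := fun i j =>
    congrArg (fun x => (1 / 2 : ℝ) * x) (hA.sum_inv_mul₃ (fun a b c => riem G i a b c y)
      (fun a b c => riem G j a b c y))
  simp only [h, fr2, fr_const_mul, fr_sum, fr_mul_const, fr4]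

theorem riemNormSq_eq : riemNormSq G y = (1 / 4) * ∑ d, ∑ c, ∑ b, ∑ a,
    fr4 A (fun i j k l => riem G i j k l y) a b c d *
      fr4 A (fun i j k l => riem G i j k l y) a b c d :=
  congrArg (fun x => (1 / 4 : ℝ) * x) (hA.sum_inv_mul₄ (fun i j k l => riem G i j k l y)
    (fun i j k l => riem G i j k l y))

theorem fr2_metric_kd (a b : Fin 3) : fr2 A (fun i j => G y i j) a b = kd a b :=
  hA.fr2_metric a b

theorem fr2_einsteinTensor (p q : Fin 3) : fr2 A (fun i j => einsteinTensor G y i j) p q =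
    ∑ c, fr4 A (fun i j k l => riem G i j k l y) c p q c -
      (1 / 2) * (∑ b, ∑ a, fr4 A (fun i j k l => riem G i j k l y) a b b a) * kd p q := by
  rw [← hA.fr2_ric, ← hA.scal_eq, ← hA.fr2_metric_kd]
  simp only [einsteinTensor, Matrix.of_apply, fr2, fr_sub, fr_const_mul]

theorem riem_eq_ofEinstein (hG : IsMetricOn G U) (hy : y ∈ U) :
    fr4 A (fun i j k l => riem G i j k l y) =
      ofEinstein (fr2 A fun i j => einsteinTensor G y i j) := by
  funext i j k l
  exact (hG.isCurvatureLike hy).fr4.eq_ofEinstein hA.fr2_einsteinTensor i j k l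

theorem fr2_einsteinTensor_symm (hG : IsMetricOn G U) (hy : y ∈ U) (p q : Fin 3) :
    fr2 A (fun i j => einsteinTensor G y i j) p q =
      fr2 A (fun i j => einsteinTensor G y i j) q p := by
  have h := (hG.isCurvatureLike hy).fr4 (A := A)
  have hk : kd p q = kd q p := by simp only [kd, eq_comm]
  rw [hA.fr2_einsteinTensor, hA.fr2_einsteinTensor, hk]
  congr 1
  refine Finset.sum_congr rfl fun c _ => ?_
  rw [h.pair_symm, h.antisymm_left, h.antisymm_right, neg_neg]

end IsFrame

end FrameCurvature

/-! ### Local constancy of the dilaton. -/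

section Soliton

/-- A soliton with vanishing torsion and harmonic curvature, in coordinates. -/
structure IsLocalSoliton (κ : ℝ) (G : E3 → Matrix (Fin 3) (Fin 3) ℝ) (f : E3 → ℝ)
    (U : Set E3) : Prop where
  isMetricOn : IsMetricOn G U
  smooth : ContDiffOn ℝ ∞ f U
  einstein : ∀ y ∈ U, ∀ i j, ric G i j y + hess G f i j y
      - (1 / 2) * Real.exp (2 * f y) * G y i j + κ * riemSq G i j y = 0
  harmonic : ∀ y ∈ U, ∀ j k l, codiffRiem G j k l y = 0
  nullity : ∀ y ∈ U, ∀ j k l, riemD G f j k l y = 0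
  dilaton : ∀ y ∈ U, codiffD G f y + dNormSq G f y - Real.exp (2 * f y)
      + κ * riemNormSq G y = 0

variable {A : Matrix (Fin 3) (Fin 3) ℝ} {G : E3 → Matrix (Fin 3) (Fin 3) ℝ} {U : Set E3} {y : E3}
  {κ : ℝ} {f : E3 → ℝ}

namespace IsLocalSoliton

variable (hS : IsLocalSoliton κ G f U)
include hS

theorem frame_einstein (hy : y ∈ U) (hA : IsFrame A (G y) (G y)⁻¹) (i j : Fin 3) :
    ∑ a, fr4 A (fun i j k l => riem G i j k l y) a i j a + fr2 A (fun i j => hess G f i j y) i j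
      - (1 / 2) * Real.exp (2 * f y) * kd i j + κ * ((1 / 2) *
      ∑ c, ∑ b, ∑ a, fr4 A (fun i j k l => riem G i j k l y) i a b c *
        fr4 A (fun i j k l => riem G i j k l y) j a b c) = 0 := by
  rw [← hA.fr2_ric, ← hA.fr2_riemSq, ← hA.fr2_metric_kd]
  have h : fr2 A (fun i j => ric G i j y + hess G f i j y
      - (1 / 2) * Real.exp (2 * f y) * G y i j + κ * riemSq G i j y) i j = 0 := by
    simp only [hS.einstein y hy, fr2, fr_zero]
  rw [← h]
  simp only [fr2, fr_add, fr_sub, fr_const_mul]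

theorem frame_dilaton (hy : y ∈ U) (hA : IsFrame A (G y) (G y)⁻¹) :
    -∑ i, fr2 A (fun i j => hess G f i j y) i i +
      ∑ i, fr A (fun i => pd i f y) i * fr A (fun i => pd i f y) i - Real.exp (2 * f y) +
      κ * ((1 / 4) * ∑ d, ∑ c, ∑ b, ∑ a, fr4 A (fun i j k l => riem G i j k l y) a b c d *
        fr4 A (fun i j k l => riem G i j k l y) a b c d) = 0 := by
  rw [← hA.riemNormSq_eq, ← hS.dilaton y hy, ← hA.sum_inv, ← hA.sum_inv_mul]
  rfl

/-- Nullity moved from the first slot to the last, leaving the first slot free for the divergence in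
`riem_hess_eq_zero`. -/
theorem riem_grad (hy : y ∈ U) (j k l : Fin 3) :
    ∑ b, riem G j k l b y * grad G f b y = 0 := by
  have h := hS.nullity y hy l k j
  rw [hS.isMetricOn.riemD_eq_grad hy] at h
  rw [← h]
  refine Finset.sum_congr rfl fun b _ => ?_
  have hR := hS.isMetricOn.isCurvatureLike hy
  have e : riem G j k l b y = riem G b l k j y := by
    have h1 := hR.pair_symm j k l b
    have h2 := hR.antisymm_left l b j k
    have h3 := hR.antisymm_right b l j k
    rw [h1, h2, h3, neg_neg]
  rw [e, mul_comm]

theorem frame_nullity (hy : y ∈ U) (hA : IsFrame A (G y) (G y)⁻¹) (j k l : Fin 3) :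
    ∑ i, fr A (fun i => pd i f y) i * fr4 A (fun i j k l => riem G i j k l y) i j k l = 0 := by
  have h1 := hA.sum_inv_mul (fun i => pd i f y) (fun i => fr3 A (fun j k l => riem G i j k l y) j k l)
  have h2 : fr3 A (fun j k l => ∑ a, ∑ b, ginv G y a b * pd a f y * riem G b j k l y) j k l = 0 := by
    have h3 := hS.nullity y hy
    simp only [riemD] at h3
    simp only [h3, fr3, fr2, fr_zero]
  simp only [fr3, fr2, fr_sum, fr_const_mul, mul_assoc] at h1 h2
  exact h1.symm.trans h2

theorem frame_hess (hy : y ∈ U) (hA : IsFrame A (G y) (G y)⁻¹) (k l : Fin 3) :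
    ∑ j, ∑ b, fr4 A (fun i j k l => riem G i j k l y) j k l b *
      fr2 A (fun i j => hess G f i j y) j b = 0 := by
  have h0 : ∀ k l, ∑ d, ∑ c, fr2 A (fun j b => riem G j k l b y) c d *
      fr2 A (fun i j => hess G f i j y) c d = 0 := by
    intro k l
    rw [← hA.sum_inv_mul₂, ← hS.isMetricOn.riem_hess_eq_zero hS.smooth
      (fun z hz => hS.riem_grad hz) (fun k l b => hS.harmonic y hy k l b) hy k l, Finset.sum_comm]
    refine Finset.sum_congr rfl fun a _ => Finset.sum_congr rfl fun a' _ => ?_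
    rw [Finset.mul_sum]
    refine Finset.sum_congr rfl fun b _ => ?_
    rw [Finset.mul_sum, Finset.mul_sum]
    refine Finset.sum_congr rfl fun c _ => ?_
    have hs := hS.isMetricOn.ginv_symm hy a a'
    simp only [ginv] at hs ⊢
    rw [hs]
    ring
  have h1 : fr2 A (fun k l => ∑ d, ∑ c, fr2 A (fun j b => riem G j k l b y) c d *
      fr2 A (fun i j => hess G f i j y) c d) k l = 0 := by
    have h : (fun k l => ∑ d, ∑ c, fr2 A (fun j b => riem G j k l b y) c d *
        fr2 A (fun i j => hess G f i j y) c d) = fun _ _ => 0 := by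
      funext k l; exact h0 k l
    rw [h]
    simp only [fr2, fr_zero]
  rw [Finset.sum_comm, ← h1]
  have h2 : ∀ c d, fr4 A (fun i j k l => riem G i j k l y) c k l d =
      fr A (fun k => fr A (fun l => fr2 A (fun j b => riem G j k l b y) c d) l) k := fun c d =>
    (fr_rotate (fun a i j => fr A (fun b => riem G a i j b y) d) c k l).symm
  simp only [h2]
  rw [fr2]
  simp only [fr_sum, fr_mul_const]

theorem relation (hy : y ∈ U) (hv : dNormSq G f y ≠ 0) :
    (dNormSq G f y - 5 / 2 * Real.exp (2 * f y)) *
      (2 * (dNormSq G f y - Real.exp (2 * f y)) +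
      2 * κ * (dNormSq G f y - Real.exp (2 * f y)) ^ 2 - Real.exp (2 * f y)) = 0 := by
  obtain ⟨A, hA⟩ := exists_isFrame (hS.isMetricOn.posDef y hy)
  have hF : dNormSq G f y = ∑ i, fr A (fun i => pd i f y) i * fr A (fun i => pd i f y) i :=
    hA.sum_inv_mul _ _
  rw [hF] at hv ⊢
  have hR := hA.riem_eq_ofEinstein hS.isMetricOn hy
  have h1 := hS.frame_nullity hy hA
  have h2 := hS.frame_einstein hy hA
  have h3 := hS.frame_dilaton hy hA
  have h4 := hS.frame_hess hy hA
  rw [hR] at h1 h2 h3 h4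
  exact nullity_relation (hA.fr2_einsteinTensor_symm hS.isMetricOn hy) hv h1 h2 h3 h4

/-- Both `Ric` and `R ∘ R` annihilate the gradient, so only the `e^{2φ}` term of the Einstein
equation survives. -/
theorem hess_grad (hy : y ∈ U) (p : Fin 3) :
    ∑ c, hess G f p c y * grad G f c y = (1 / 2) * Real.exp (2 * f y) * pd p f y := by
  have hR := hS.isMetricOn.isCurvatureLike hy
  have hric : ∑ c, ric G p c y * grad G f c y = 0 := by
    have e : ∀ a b, ∑ c, riem G a p c b y * grad G f c y = 0 := by
      intro a b
      have h := hS.riem_grad hy a p b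
      have hn : ∀ c, riem G a p c b y = -riem G a p b c y := fun c => hR.antisymm_right a p c b
      simp only [hn, neg_mul, Finset.sum_neg_distrib, h, neg_zero]
    have e2 : ∑ c, ric G p c y * grad G f c y =
        ∑ a, ∑ b, ginv G y a b * ∑ c, riem G a p c b y * grad G f c y := by
      simp only [ric, Fin.sum_univ_three]; ring
    simp only [e2, e, mul_zero, Finset.sum_const_zero]
  have hsq : ∑ c, riemSq G p c y * grad G f c y = 0 := by
    have e : ∀ i j k, ∑ c, riem G c i j k y * grad G f c y = 0 := by
      intro i j k
      have h := hS.nullity y hy i j k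
      rw [hS.isMetricOn.riemD_eq_grad hy] at h
      simpa only [mul_comm] using h
    simp only [riemSq, mul_assoc, Finset.mul_sum, Finset.sum_mul]
    rw [Finset.sum_comm]
    refine Finset.sum_eq_zero fun i _ => ?_
    rw [Finset.sum_comm]
    refine Finset.sum_eq_zero fun i' _ => ?_
    rw [Finset.sum_comm]
    refine Finset.sum_eq_zero fun j _ => ?_
    rw [Finset.sum_comm]
    refine Finset.sum_eq_zero fun j' _ => ?_
    rw [Finset.sum_comm]
    refine Finset.sum_eq_zero fun k _ => ?_
    rw [Finset.sum_comm]
    refine Finset.sum_eq_zero fun k' _ => ?_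
    simp only [← Finset.mul_sum, e, mul_zero]
  have hh : ∀ c, hess G f p c y = (1 / 2) * Real.exp (2 * f y) * G y p c - ric G p c y -
      κ * riemSq G p c y := fun c => by linarith [hS.einstein y hy p c]
  simp only [hh, sub_mul, Finset.sum_sub_distrib, mul_assoc, ← Finset.mul_sum, hric, hsq,
    hS.isMetricOn.metric_grad hy]
  ring

theorem pd_dNormSq (hy : y ∈ U) (p : Fin 3) :
    pd p (dNormSq G f) y = Real.exp (2 * f y) * pd p f y := by
  rw [hS.isMetricOn.pd_dNormSq hS.smooth hy, hS.hess_grad hy]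
  ring

theorem smooth_exp : ContDiffOn ℝ ∞ (fun z => Real.exp (2 * f z)) U :=
  (contDiffOn_const.mul hS.smooth).exp

theorem pd_exp (hy : y ∈ U) (p : Fin 3) :
    pd p (fun z => Real.exp (2 * f z)) y = 2 * Real.exp (2 * f y) * pd p f y := by
  have hd := differentiableAt_of_contDiffOn hS.isMetricOn.isOpen hS.smooth hy
  have h := ((hd.hasFDerivAt.const_mul 2).exp).fderiv
  rw [pd, h, pd]
  simp
  ring

theorem pd_eq_zero_of_dNormSq (hy : y ∈ U) (h : dNormSq G f y = 0) (p : Fin 3) :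
    pd p f y = 0 := by
  obtain ⟨A, hA⟩ := exists_isFrame (hS.isMetricOn.posDef y hy)
  have hF : dNormSq G f y = ∑ i, fr A (fun i => pd i f y) i * fr A (fun i => pd i f y) i :=
    hA.sum_inv_mul _ _
  rw [hF, Finset.sum_eq_zero_iff_of_nonneg fun i _ => mul_self_nonneg _] at h
  have h0 : (fun i => pd i f y) = fun _ => 0 := hA.fr_injective fun a => by
    rw [fr_zero, mul_self_eq_zero.1 (h a (Finset.mem_univ a))]
  exact congrFun h0 p

/-- Excludes the second factor of `relation`: where the first factor and `dφ` are non-zero, the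
second vanishes on an open set and may be differentiated. -/
theorem dNormSq_sub_eq_zero (hy : y ∈ U) (hv : dNormSq G f y ≠ 0) :
    dNormSq G f y - 5 / 2 * Real.exp (2 * f y) = 0 := by
  by_contra hne
  have hU := hS.isMetricOn.isOpen
  have hF := hS.isMetricOn.smooth_dNormSq hS.smooth
  have hE := hS.smooth_exp
  have hc : ContinuousOn (fun z => dNormSq G f z *
      (dNormSq G f z - 5 / 2 * Real.exp (2 * f z))) U :=
    (hF.mul (hF.sub (contDiffOn_const.mul hE))).continuousOn
  have hV := hc.isOpen_inter_preimage hU (isOpen_compl_singleton (x := (0 : ℝ)))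
  have hzero : ∀ z ∈ U ∩ (fun z => dNormSq G f z *
      (dNormSq G f z - 5 / 2 * Real.exp (2 * f z))) ⁻¹' {0}ᶜ,
      2 * (dNormSq G f z - Real.exp (2 * f z)) + 2 * κ * ((dNormSq G f z - Real.exp (2 * f z)) *
        (dNormSq G f z - Real.exp (2 * f z))) - Real.exp (2 * f z) = 0 := by
    rintro z ⟨hz, hz2⟩
    have hz3 : dNormSq G f z * (dNormSq G f z - 5 / 2 * Real.exp (2 * f z)) ≠ 0 := hz2
    have h := (mul_eq_zero.1 (hS.relation hz (left_ne_zero_of_mul hz3))).resolve_left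
      (right_ne_zero_of_mul hz3)
    rw [← h]; ring
  have hyV : y ∈ U ∩ (fun z => dNormSq G f z *
      (dNormSq G f z - 5 / 2 * Real.exp (2 * f z))) ⁻¹' {0}ᶜ := ⟨hy, mul_ne_zero hv hne⟩
  obtain ⟨p, hp⟩ : ∃ p, pd p f y ≠ 0 := by
    by_contra hcon
    push Not at hcon
    exact hv (by simp [dNormSq, hcon])
  have hdF := differentiableAt_of_contDiffOn hU hF hy
  have hdE := differentiableAt_of_contDiffOn hU hE hy
  have hd := pd_congr hV hzero hyV p
  have d1 : DifferentiableAt ℝ (fun z => dNormSq G f z - Real.exp (2 * f z)) y := hdF.sub hdE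
  have d2 : DifferentiableAt ℝ (fun z => (dNormSq G f z - Real.exp (2 * f z)) *
      (dNormSq G f z - Real.exp (2 * f z))) y := d1.mul d1
  have d3 : DifferentiableAt ℝ (fun z => 2 * (dNormSq G f z - Real.exp (2 * f z))) y :=
    d1.const_mul 2
  have d4 : DifferentiableAt ℝ (fun z => 2 * κ * ((dNormSq G f z - Real.exp (2 * f z)) *
      (dNormSq G f z - Real.exp (2 * f z)))) y := d2.const_mul _
  have d5 : DifferentiableAt ℝ (fun z => 2 * (dNormSq G f z - Real.exp (2 * f z)) +
      2 * κ * ((dNormSq G f z - Real.exp (2 * f z)) *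
        (dNormSq G f z - Real.exp (2 * f z)))) y := d3.add d4
  rw [pd_const, pd_sub d5 hdE, pd_add d3 d4, pd_mul (differentiableAt_const _) d1,
    pd_mul (differentiableAt_const _) d2, pd_mul d1 d1, pd_sub hdF hdE, pd_const, pd_const,
    hS.pd_dNormSq hy, hS.pd_exp hy] at hd
  have hpos := (Real.exp_pos (2 * f y)).ne'
  -- Since `d(F - E) = -E dφ`, the derivative of the second factor is `-4E (1 + κ(F - E)) dφ`.
  -- Substituting `κ(F - E) = -1` back into that factor leaves `E = 0`.
  have hk : 1 + κ * (dNormSq G f y - Real.exp (2 * f y)) = 0 := by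
    apply mul_left_cancel₀ (mul_ne_zero hpos hp)
    linear_combination (-1 / 4 : ℝ) * hd
  apply hpos
  linear_combination 2 * (dNormSq G f y - Real.exp (2 * f y)) * hk - hzero y hyV

/-- The dilaton is locally constant. -/
theorem pd_eq_zero (hy : y ∈ U) (p : Fin 3) : pd p f y = 0 := by
  by_contra hp
  have hv : dNormSq G f y ≠ 0 := fun h => hp (hS.pd_eq_zero_of_dNormSq hy h p)
  have hU := hS.isMetricOn.isOpen
  have hF := hS.isMetricOn.smooth_dNormSq hS.smooth
  have hV := hF.continuousOn.isOpen_inter_preimage hU (isOpen_compl_singleton (x := (0 : ℝ)))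
  -- The remaining factor `F - 5E/2` has derivative `(E - 5E) dφ = -4E dφ`.
  have hd := pd_congr hV (fun z hz => hS.dNormSq_sub_eq_zero hz.1 hz.2) ⟨hy, hv⟩ p
  have hdF := differentiableAt_of_contDiffOn hU hF hy
  have hdE := differentiableAt_of_contDiffOn hU hS.smooth_exp hy
  rw [pd_const, pd_sub hdF (hdE.const_mul _), pd_mul (differentiableAt_const _) hdE, pd_const,
    hS.pd_dNormSq hy, hS.pd_exp hy] at hd
  have h4 : Real.exp (2 * f y) * pd p f y = 0 := by linear_combination (-1 / 4 : ℝ) * hd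
  exact mul_ne_zero (Real.exp_pos _).ne' hp h4

theorem hess_eq_zero (hy : y ∈ U) (i j : Fin 3) : hess G f i j y = 0 := by
  have h : pd i (pd j f) y = 0 := by
    rw [pd_congr hS.isMetricOn.isOpen (fun z hz => hS.pd_eq_zero hz j) hy, pd_const]
  simp [hess, h, hS.pd_eq_zero hy]

end IsLocalSoliton

end Soliton

/-! ### Parallelism of the Einstein tensor and constant curvature. -/

section ConstantDilaton

open Matrix

variable {A : Matrix (Fin 3) (Fin 3) ℝ} {G : E3 → Matrix (Fin 3) (Fin 3) ℝ} {U : Set E3} {y : E3}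
  {κ : ℝ} {f : E3 → ℝ}

namespace IsMetricOn

variable (hG : IsMetricOn G U)
include hG

theorem smooth_einsteinTensor : SmoothMat (einsteinTensor G) U := by
  have hric : ∀ i j, ContDiffOn ℝ ∞ (ric G i j) U := fun i j =>
    ContDiffOn.sum fun a _ => ContDiffOn.sum fun b _ => (hG.smooth_ginv a b).mul
      (hG.smooth_riem a i j b)
  have hscal : ContDiffOn ℝ ∞ (scal G) U :=
    ContDiffOn.sum fun i _ => ContDiffOn.sum fun j _ => (hG.smooth_ginv i j).mul (hric i j)
  exact fun i j => (hric i j).sub ((contDiffOn_const.mul hscal).mul (hG.smooth i j))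

theorem einsteinTensor_symm (hy : y ∈ U) (i j : Fin 3) :
    einsteinTensor G y i j = einsteinTensor G y j i := by
  obtain ⟨A, hA⟩ := exists_isFrame (hG.posDef y hy)
  have h : (fun i j => einsteinTensor G y i j) = fun i j => einsteinTensor G y j i :=
    hA.fr2_injective fun a b => by
      rw [hA.fr2_einsteinTensor_symm hG hy]
      simp only [fr2]
      rw [fr_comm]
  exact congrFun (congrFun h i) j

theorem sum_ginv_mul_einsteinTensor (hy : y ∈ U) :
    ∑ i, ∑ j, ginv G y i j * einsteinTensor G y i j = -(1 / 2) * scal G y := by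
  have h3 : ∑ i, ∑ j, ginv G y i j * G y i j = 3 := by
    have h := congrArg Matrix.trace (hG.inv_mul hy)
    rw [Matrix.trace_one] at h
    simp only [Matrix.trace, Matrix.diag, Matrix.mul_apply] at h
    rw [show (3 : ℝ) = (Fintype.card (Fin 3) : ℝ) by simp, ← h]
    exact Finset.sum_congr rfl fun i _ => Finset.sum_congr rfl fun j _ => by
      rw [hG.symm_apply hy i j]; rfl
  have h : ∑ i, ∑ j, ginv G y i j * einsteinTensor G y i j =
      scal G y - (1 / 2) * scal G y * ∑ i, ∑ j, ginv G y i j * G y i j := by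
    conv_rhs => enter [1]; rw [scal]
    simp only [einsteinTensor, Matrix.of_apply, Fin.sum_univ_three]
    ring
  rw [h, h3]; ring

end IsMetricOn

/-- The covariant derivative of a field of bilinear forms. -/
noncomputable def covMat (G S : E3 → Matrix (Fin 3) (Fin 3) ℝ) (p : Fin 3) (y : E3) :
    Matrix (Fin 3) (Fin 3) ℝ :=
  mpd p S y - ((gam G p y)ᵀ * S y + S y * gam G p y)

/-- A totally symmetric trilinear form `T` with `T(N x, y, z) = -T(x, N y, z)`, where `N` has
non-zero scalar square, vanishes. -/
theorem eq_zero_of_anticommute {T : Fin 3 → Matrix (Fin 3) (Fin 3) ℝ}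
    {N : Matrix (Fin 3) (Fin 3) ℝ} {ρ : ℝ} (hρ : ρ ≠ 0) (hN : N * N = ρ • 1)
    (hT : ∀ i j k, T i j k = T j i k) (hT' : ∀ i j k, T i j k = T i k j)
    (hTN : ∀ p, T p * N + Nᵀ * T p = 0) (p : Fin 3) : T p = 0 := by
  have h1 : ∀ i j p, ∑ m, N m i * T m p j = -∑ m, N m j * T m p i := by
    intro i j p
    have h := congrFun (congrFun (hTN p) i) j
    simp only [Matrix.add_apply, Matrix.mul_apply, Matrix.transpose_apply, Matrix.zero_apply] at h
    have e1 : ∑ m, N m i * T m p j = ∑ m, N m i * T p m j :=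
      Finset.sum_congr rfl fun m _ => by rw [hT m p j]
    have e2 : ∑ m, N m j * T m p i = ∑ m, T p i m * N m j :=
      Finset.sum_congr rfl fun m _ => by rw [hT m p i, hT' p m i, mul_comm]
    rw [e1, e2]; linarith
  have h2 : ∀ i p j, ∑ m, N m i * T m p j = ∑ m, N m i * T m j p := fun i p j =>
    Finset.sum_congr rfl fun m _ => by rw [hT' m p j]
  -- Write `a(i; p, j) = T(N eᵢ, eₚ, eⱼ)`. It is symmetric in `p, j` and changes sign under swapping
  -- `i` with either of them; three such swaps give `a = -a`.
  have h3 : ∀ i p j, ∑ m, N m i * T m p j = 0 := by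
    intro i p j
    have a1 := h1 i j p
    have a2 := h1 j p i
    have a3 := h1 p i j
    have b1 := h2 j p i
    have b2 := h2 p i j
    have b3 := h2 i p j
    linarith
  ext q r
  have h4 : ∑ x, N x p * ∑ m, N m x * T m q r = ρ * T p q r := by
    have e : ∀ m, ∑ x, N m x * N x p = ρ * (if m = p then 1 else 0) := by
      intro m
      have h := congrFun (congrFun hN m) p
      simpa only [Matrix.mul_apply, Matrix.smul_apply, Matrix.one_apply, smul_eq_mul] using h
    have e2 : ∑ x, N x p * ∑ m, N m x * T m q r = ∑ m, (∑ x, N m x * N x p) * T m q r := by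
      simp only [Fin.sum_univ_three]; ring
    rw [e2]
    simp [e]
  simp only [h3, mul_zero, Finset.sum_const_zero] at h4
  exact (mul_eq_zero.1 h4.symm).resolve_left hρ

/-- The covariant Leibniz rule for `κ W g⁻¹ W = W + c g` with `c` constant. In `h` the partials of
`W`, `H = g⁻¹` and `g` are written out; all `Γ` terms cancel by the equation itself. -/
theorem smul_mul_add_mul_eq_of_sq {W H g Γ T : Matrix (Fin 3) (Fin 3) ℝ} {κ c : ℝ}
    (hsq : κ • (W * H * W) = W + c • g)
    (h : κ • (((T + (Γᵀ * W + W * Γ)) * H + W * -(Γ * H + H * Γᵀ)) * W +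
      W * H * (T + (Γᵀ * W + W * Γ))) = T + (Γᵀ * W + W * Γ) + c • (Γᵀ * g + g * Γ)) :
    κ • (T * (H * W) + W * H * T) = T := by
  have e1 : κ • (((T + (Γᵀ * W + W * Γ)) * H + W * -(Γ * H + H * Γᵀ)) * W +
      W * H * (T + (Γᵀ * W + W * Γ))) = κ • (T * (H * W) + W * H * T) +
      (Γᵀ * (κ • (W * H * W)) + (κ • (W * H * W)) * Γ) := by
    simp only [Matrix.mul_smul, Matrix.smul_mul, ← smul_add]
    congr 1
    noncomm_ring
  have e2 : T + (Γᵀ * W + W * Γ) + c • (Γᵀ * g + g * Γ) =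
      T + (Γᵀ * (W + c • g) + (W + c • g) * Γ) := by
    simp only [mul_add, add_mul, Matrix.mul_smul, Matrix.smul_mul, smul_add]
    abel
  rw [e1, e2, hsq] at h
  exact add_right_cancel h

namespace IsLocalSoliton

variable (hS : IsLocalSoliton κ G f U)
include hS

theorem frame_einsteinTensor (hy : y ∈ U) (hA : IsFrame A (G y) (G y)⁻¹) :
    (∀ i j, κ * ∑ a, fr2 A (fun i j => einsteinTensor G y i j) i a *
      fr2 A (fun i j => einsteinTensor G y i j) a j =
      fr2 A (fun i j => einsteinTensor G y i j) i j + Real.exp (2 * f y) / 4 * kd i j) ∧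
    ∑ a, fr2 A (fun i j => einsteinTensor G y i j) a a = Real.exp (2 * f y) / 4 ∧
    κ * ∑ a, ∑ b, fr2 A (fun i j => einsteinTensor G y i j) a b *
      fr2 A (fun i j => einsteinTensor G y i j) a b = Real.exp (2 * f y) := by
  have hR := hA.riem_eq_ofEinstein hS.isMetricOn hy
  have hW := hA.fr2_einsteinTensor_symm hS.isMetricOn hy
  have h2 := hS.frame_einstein hy hA
  have h3 := hS.frame_dilaton hy hA
  have hh : fr2 A (fun i j => hess G f i j y) = fun _ _ => 0 := by
    funext i j
    simp only [hS.hess_eq_zero hy, fr2, fr_zero]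
  have hp : fr A (fun i => pd i f y) = fun _ => 0 := by
    funext i
    simp only [hS.pd_eq_zero hy, fr_zero]
  rw [hR, hh] at h2 h3
  rw [hp] at h3
  set W := fr2 A fun i j => einsteinTensor G y i j
  set E := Real.exp (2 * f y)
  simp only [ric_ofEinstein, sq_ofEinstein hW, normSq_ofEinstein hW] at h2 h3
  simp only [mul_zero, Finset.sum_const_zero, neg_zero, add_zero, zero_sub] at h2 h3
  set t := ∑ a, W a a with ht
  set N := ∑ a, ∑ b, W a b * W a b with hN
  have hκN : κ * N = E := by linarith
  -- The trace of the Einstein equation is `-2t + 3E/2 = κ|W|²`, and the dilaton equation is `κ|W|²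
  -- = E`.
  have htr : t = E / 4 := by
    have h00 := h2 0 0
    have h11 := h2 1 1
    have h22 := h2 2 2
    have hN' : N = ∑ i, ∑ a, W i a * W a i :=
      Finset.sum_congr rfl fun i _ => Finset.sum_congr rfl fun a _ => by rw [hW a i]
    simp only [Fin.sum_univ_three] at ht hN' h00 h11 h22
    simp only [kd, if_true] at h00 h11 h22
    linear_combination (-1 / 2 : ℝ) * (h00 + h11 + h22) - ht / 2 + κ * hN' / 2 + hκN
  refine ⟨fun i j => ?_, htr, hκN⟩
  linear_combination -h2 i j - kd i j * htr + kd i j * hκN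

theorem scal_eq (hy : y ∈ U) : scal G y = -(1 / 2) * Real.exp (2 * f y) := by
  obtain ⟨A, hA⟩ := exists_isFrame (hS.isMetricOn.posDef y hy)
  have h1 : ∑ i, ∑ j, ginv G y i j * einsteinTensor G y i j = _ :=
    hA.sum_inv (fun i j => einsteinTensor G y i j)
  rw [(hS.frame_einsteinTensor hy hA).2.1, hS.isMetricOn.sum_ginv_mul_einsteinTensor hy] at h1
  linarith

theorem kappa_pos (hy : y ∈ U) : 0 < κ := by
  obtain ⟨A, hA⟩ := exists_isFrame (hS.isMetricOn.posDef y hy)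
  have h := (hS.frame_einsteinTensor hy hA).2.2
  have hE := Real.exp_pos (2 * f y)
  rw [← h] at hE
  exact pos_of_mul_pos_left hE
    (Finset.sum_nonneg fun i _ => Finset.sum_nonneg fun j _ => mul_self_nonneg _)

theorem einsteinTensor_sq (hy : y ∈ U) :
    κ • (einsteinTensor G y * (G y)⁻¹ * einsteinTensor G y) =
      einsteinTensor G y + (Real.exp (2 * f y) / 4) • G y := by
  obtain ⟨A, hA⟩ := exists_isFrame (hS.isMetricOn.posDef y hy)
  have h := (hS.frame_einsteinTensor hy hA).1
  have key : (fun i j => κ * ∑ a, ∑ b, (G y)⁻¹ a b *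
      (einsteinTensor G y i a * einsteinTensor G y b j)) =
      fun i j => einsteinTensor G y i j + (Real.exp (2 * f y) / 4) * G y i j := by
    refine hA.fr2_injective fun p q => ?_
    have e1 : fr2 A (fun i j => einsteinTensor G y i j +
        (Real.exp (2 * f y) / 4) * G y i j) p q = fr2 A (fun i j => einsteinTensor G y i j) p q +
        Real.exp (2 * f y) / 4 * kd p q := by
      rw [← hA.fr2_metric_kd]
      simp only [fr2, fr_add, fr_const_mul]
    rw [e1, ← h]
    have e2 : ∀ i j, ∑ a, ∑ b, (G y)⁻¹ a b * (einsteinTensor G y i a * einsteinTensor G y b j) =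
        ∑ c, fr A (fun a => einsteinTensor G y i a) c * fr A (fun b => einsteinTensor G y b j) c :=
      fun i j => hA.sum_inv_mul _ _
    simp only [e2, fr2, fr_const_mul, fr_sum, fr_mul_const]
    congr 1
    refine Finset.sum_congr rfl fun c _ => ?_
    congr 1
    exact fr_comm _ _ _
  ext i j
  have hk := congrFun (congrFun key i) j
  simp only [Matrix.smul_apply, Matrix.add_apply, smul_eq_mul]
  rw [← hk]
  simp only [Matrix.mul_apply, Fin.sum_univ_three]
  ring

theorem riem_eq (hy : y ∈ U) (i j k l : Fin 3) : riem G i j k l y =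
    einsteinTensor G y i l * G y j k + einsteinTensor G y j k * G y i l -
      einsteinTensor G y i k * G y j l - einsteinTensor G y j l * G y i k -
      Real.exp (2 * f y) / 4 * (G y i l * G y j k - G y i k * G y j l) := by
  obtain ⟨A, hA⟩ := exists_isFrame (hS.isMetricOn.posDef y hy)
  have htr := (hS.frame_einsteinTensor hy hA).2.1
  have key : (fun i j k l => riem G i j k l y) = fun i j k l =>
    einsteinTensor G y i l * G y j k + einsteinTensor G y j k * G y i l -
      einsteinTensor G y i k * G y j l - einsteinTensor G y j l * G y i k -
      Real.exp (2 * f y) / 4 * (G y i l * G y j k - G y i k * G y j l) := by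
    refine hA.fr4_injective fun a b c d => ?_
    rw [hA.riem_eq_ofEinstein hS.isMetricOn hy]
    simp only [ofEinstein, htr, ← hA.fr2_metric_kd]
    simp only [fr4, fr3, fr2, fr_add, fr_sub, fr_const_mul, fr_mul_const]
  exact congrFun (congrFun (congrFun (congrFun key i) j) k) l

theorem pd_exp_eq_zero (hy : y ∈ U) (p : Fin 3) (c : ℝ) :
    pd p (fun z => Real.exp (2 * f z) / c) y = 0 := by
  have hd := differentiableAt_of_contDiffOn hS.isMetricOn.isOpen hS.smooth_exp hy
  simp only [div_eq_mul_inv]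
  rw [pd_mul hd (differentiableAt_const _), hS.pd_exp hy, hS.pd_eq_zero hy, pd_const]
  ring

/-- In `riem_eq` the metric is parallel and `e^{2φ}` has zero derivative, so only `W` is
differentiated. -/
theorem covRiem_eq (hy : y ∈ U) (p i j k l : Fin 3) : covRiem G p i j k l y =
    covMat G (einsteinTensor G) p y i l * G y j k + covMat G (einsteinTensor G) p y j k * G y i l -
      covMat G (einsteinTensor G) p y i k * G y j l -
      covMat G (einsteinTensor G) p y j l * G y i k := by
  have hU := hS.isMetricOn.isOpen
  have hW := fun a b => hS.isMetricOn.smooth_einsteinTensor.differentiableAt hU hy a b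
  have hg := fun a b => hS.isMetricOn.smooth.differentiableAt hU hy a b
  have hE : DifferentiableAt ℝ (fun z => Real.exp (2 * f z) / 4) y :=
    differentiableAt_of_contDiffOn hU (hS.smooth_exp.div_const (4 : ℝ)) hy
  have hWg : ∀ a b c d, DifferentiableAt ℝ (fun z => einsteinTensor G z a b * G z c d) y :=
    fun a b c d => (hW a b).mul (hg c d)
  have hgg : ∀ a b c d, DifferentiableAt ℝ (fun z => G z a b * G z c d) y :=
    fun a b c d => (hg a b).mul (hg c d)
  have d1 : DifferentiableAt ℝ (fun z => einsteinTensor G z i l * G z j k +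
    einsteinTensor G z j k * G z i l) y := (hWg _ _ _ _).add (hWg _ _ _ _)
  have d2 : DifferentiableAt ℝ (fun z => einsteinTensor G z i l * G z j k +
    einsteinTensor G z j k * G z i l - einsteinTensor G z i k * G z j l) y :=
    d1.sub (hWg _ _ _ _)
  have d3 : DifferentiableAt ℝ (fun z => einsteinTensor G z i l * G z j k +
    einsteinTensor G z j k * G z i l - einsteinTensor G z i k * G z j l -
    einsteinTensor G z j l * G z i k) y := d2.sub (hWg _ _ _ _)
  have d4 : DifferentiableAt ℝ (fun z => G z i l * G z j k - G z i k * G z j l) y :=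
    (hgg _ _ _ _).sub (hgg _ _ _ _)
  have d5 : DifferentiableAt ℝ (fun z => Real.exp (2 * f z) / 4 *
    (G z i l * G z j k - G z i k * G z j l)) y := hE.mul d4
  have hpg : ∀ a b, pd p (fun z => G z a b) y = ∑ q, (christoffel G q p a y * G y q b +
      G y a q * christoffel G q p b y) := by
    intro a b
    have h := congrFun (congrFun (hS.isMetricOn.mpd_metric hy p) a) b
    simpa only [mpd, gam, Matrix.of_apply, Matrix.add_apply, Matrix.mul_apply,
      Matrix.transpose_apply, ← Finset.sum_add_distrib] using h
  have hpW : ∀ a b, pd p (fun z => einsteinTensor G z a b) y =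
      covMat G (einsteinTensor G) p y a b + ∑ q, (christoffel G q p a y * einsteinTensor G y q b +
      einsteinTensor G y a q * christoffel G q p b y) := by
    intro a b
    simp only [covMat, mpd, gam, Matrix.of_apply, Matrix.sub_apply, Matrix.add_apply,
      Matrix.mul_apply, Matrix.transpose_apply, Finset.sum_add_distrib]
    ring
  rw [covRiem, pd_congr hU (fun z hz => hS.riem_eq hz i j k l) hy, pd_sub d3 d5,
    pd_sub d2 (hWg _ _ _ _), pd_sub d1 (hWg _ _ _ _), pd_add (hWg _ _ _ _) (hWg _ _ _ _),
    pd_mul hE d4, pd_sub (hgg _ _ _ _) (hgg _ _ _ _), hS.pd_exp_eq_zero hy]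
  simp only [pd_mul (hW _ _) (hg _ _), pd_mul (hg _ _) (hg _ _), hpg, hpW, hS.riem_eq hy,
    Fin.sum_univ_three]
  ring

theorem trace_covMat (hy : y ∈ U) (p : Fin 3) :
    ∑ i, ∑ j, ginv G y i j * covMat G (einsteinTensor G) p y i j = 0 := by
  have hU := hS.isMetricOn.isOpen
  have hW := fun a b => hS.isMetricOn.smooth_einsteinTensor.differentiableAt hU hy a b
  have hg := fun a b => differentiableAt_of_contDiffOn hU (hS.isMetricOn.smooth_ginv a b) hy
  have h : ∀ z ∈ U, ∑ i, ∑ j, ginv G z i j * einsteinTensor G z i j = Real.exp (2 * f z) / 4 := by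
    intro z hz
    rw [hS.isMetricOn.sum_ginv_mul_einsteinTensor hz, hS.scal_eq hz]
    ring
  have hd := pd_congr hU h hy p
  rw [hS.pd_exp_eq_zero hy, pd_sum (F := fun i z => ∑ j, ginv G z i j * einsteinTensor G z i j)
    fun i => DifferentiableAt.fun_sum fun j _ => (hg i j).mul (hW i j)] at hd
  have hd2 : ∀ i, pd p (fun z => ∑ j, ginv G z i j * einsteinTensor G z i j) y =
      ∑ j, (pd p (fun z => ginv G z i j) y * einsteinTensor G y i j +
        ginv G y i j * pd p (fun z => einsteinTensor G z i j) y) := fun i =>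
    (pd_sum (F := fun j z => ginv G z i j * einsteinTensor G z i j)
      (fun j => (hg i j).mul (hW i j)) p).trans
      (Finset.sum_congr rfl fun j _ => pd_mul (hg i j) (hW i j) p)
  simp only [hd2, hS.isMetricOn.pd_ginv hy] at hd
  rw [← hd]
  simp only [covMat, mpd, gam, Matrix.of_apply, Matrix.sub_apply, Matrix.add_apply,
      Matrix.mul_apply, Matrix.transpose_apply, Fin.sum_univ_three]
  ring

theorem covMat_symm (hy : y ∈ U) (p i j : Fin 3) :
    covMat G (einsteinTensor G) p y i j = covMat G (einsteinTensor G) p y j i := by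
  have h : pd p (fun z => einsteinTensor G z i j) y = pd p (fun z => einsteinTensor G z j i) y :=
    pd_congr hS.isMetricOn.isOpen (fun z hz => hS.isMetricOn.einsteinTensor_symm hz i j) hy p
  have hs := hS.isMetricOn.einsteinTensor_symm hy
  simp only [covMat, mpd, gam, Matrix.of_apply, Matrix.sub_apply, Matrix.add_apply,
    Matrix.mul_apply, Matrix.transpose_apply, h, Fin.sum_univ_three]
  rw [hs 0 j, hs 1 j, hs 2 j, hs i 0, hs i 1, hs i 2]
  ring

/-- The Einstein tensor is a Codazzi tensor. -/
theorem covMat_codazzi (hy : y ∈ U) (p i j : Fin 3) :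
    covMat G (einsteinTensor G) p y i j = covMat G (einsteinTensor G) i y p j := by
  have hG := hS.isMetricOn
  set T := fun p => covMat G (einsteinTensor G) p y with hT
  set D : Fin 3 → ℝ := fun m => ∑ a, ∑ b, ginv G y a b * T a b m with hD
  have hHG : ∀ a m, ∑ b, ginv G y a b * G y b m = if a = m then 1 else 0 := by
    intro a m
    have h := congrFun (congrFun (hG.inv_mul hy) a) m
    rwa [Matrix.mul_apply, Matrix.one_apply] at h
  have h0 : ∀ k l m, D m * G y k l + T m k l - D l * G y k m - T l k m = 0 := by
    intro k l m
    have h := hS.harmonic y hy k l m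
    rw [codiffRiem, neg_eq_zero] at h
    have e : ∑ a, ∑ b, ginv G y a b * covRiem G a b k l m y =
        D m * G y k l + ∑ a, (∑ b, ginv G y a b * G y b m) * T a k l - D l * G y k m -
          ∑ a, (∑ b, ginv G y a b * G y b l) * T a k m := by
      simp only [hS.covRiem_eq hy, hD, hT, Fin.sum_univ_three]
      ring
    rw [e] at h
    simpa [hHG] using h
  -- `D` is the divergence of `W`. Tracing `h0` over `k, l` gives `3D + tr T - D - D = D`, where `tr
  -- T = 0` because `tr W` has zero derivative. With `D = 0`, `h0` is the Codazzi equation.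
  have hD0 : ∀ m, D m = 0 := by
    intro m
    have e : ∑ l, ∑ k, ginv G y l k * (D m * G y k l + T m k l - D l * G y k m - T l k m) =
        D m * ∑ l, (∑ k, ginv G y l k * G y k l) + (∑ l, ∑ k, ginv G y l k * T m k l) -
          ∑ l, D l * (∑ k, ginv G y l k * G y k m) - D m := by
      simp only [hD, Fin.sum_univ_three]
      ring
    have e2 : ∑ l, ∑ k, ginv G y l k * T m k l = 0 := by
      rw [← hS.trace_covMat hy m]
      exact Finset.sum_congr rfl fun l _ => Finset.sum_congr rfl fun k _ => by
        rw [hT]; simp only; rw [hS.covMat_symm hy m k l]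
    simp only [h0, mul_zero, Finset.sum_const_zero, hHG, e2] at e
    simp at e
    linarith
  have h := h0 j i p
  rw [hD0, hD0] at h
  have s1 := hS.covMat_symm hy p j i
  have s2 := hS.covMat_symm hy i j p
  simp only [hT] at h
  linarith

theorem covMat_mul (hy : y ∈ U) (p : Fin 3) :
    κ • (covMat G (einsteinTensor G) p y * ((G y)⁻¹ * einsteinTensor G y) +
      (einsteinTensor G y * (G y)⁻¹) * covMat G (einsteinTensor G) p y) =
      covMat G (einsteinTensor G) p y := by
  have hG := hS.isMetricOn
  have hU := hG.isOpen
  have hW := hG.smooth_einsteinTensor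
  have hE : ContDiffOn ℝ ∞ (fun z => Real.exp (2 * f z) / 4) U := hS.smooth_exp.div_const 4
  have h := mpd_congr (S := fun z => κ • (einsteinTensor G z * (G z)⁻¹ * einsteinTensor G z))
    (T := fun z => einsteinTensor G z + (Real.exp (2 * f z) / 4) • G z) hU
    (fun z hz => hS.einsteinTensor_sq hz) hy p
  have hsq := hS.einsteinTensor_sq hy
  rw [mpd_smul (c := fun _ => κ) hU contDiffOn_const ((hW.mul hG.smooth_inv).mul hW) hy, pd_const,
    mpd_mul hU (hW.mul hG.smooth_inv) hW hy, mpd_mul hU hW hG.smooth_inv hy,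
    mpd_add hU hW (hG.smooth.smul hE) hy, mpd_smul hU hE hG.smooth hy, hS.pd_exp_eq_zero hy,
    hG.mpd_inv hy, hG.mpd_metric hy] at h
  have hm : mpd p (einsteinTensor G) y = covMat G (einsteinTensor G) p y +
      ((gam G p y)ᵀ * einsteinTensor G y + einsteinTensor G y * gam G p y) := by
    rw [covMat]; abel
  rw [hm, zero_smul, zero_add, zero_smul, zero_add] at h
  exact smul_mul_add_mul_eq_of_sq hsq h

/-- The Einstein tensor is parallel. -/
theorem covMat_eq_zero (hy : y ∈ U) (p : Fin 3) : covMat G (einsteinTensor G) p y = 0 := by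
  have hG := hS.isMetricOn
  have hκ := hS.kappa_pos hy
  have hE := Real.exp_pos (2 * f y)
  have hWs : (einsteinTensor G y)ᵀ = einsteinTensor G y :=
    Matrix.ext fun i j => hG.einsteinTensor_symm hy j i
  have hsq := hS.einsteinTensor_sq hy
  have hc : κ * (1 / κ) = 1 := by field_simp
  -- Completing the square in `W² - W/κ = E/(4κ)`: the shift by `1/(2κ)` makes `N²` scalar and turns
  -- `κ(TW + WT) = T` into anticommutation. Positivity of `κ` makes `ρ` non-zero.
  refine eq_zero_of_anticommute (T := fun p => covMat G (einsteinTensor G) p y)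
    (N := (G y)⁻¹ * einsteinTensor G y - (1 / (2 * κ)) • 1)
    (ρ := Real.exp (2 * f y) / (4 * κ) + 1 / (4 * κ ^ 2)) (by positivity) ?_
    (hS.covMat_codazzi hy) (hS.covMat_symm hy) ?_ p
  · have h1 : ((G y)⁻¹ * einsteinTensor G y) * ((G y)⁻¹ * einsteinTensor G y) =
        (1 / κ) • ((G y)⁻¹ * einsteinTensor G y + (Real.exp (2 * f y) / 4) • 1) := by
      have h2 := congrArg (fun X => (1 / κ) • ((G y)⁻¹ * X)) hsq
      simp only [Matrix.mul_smul, smul_smul, mul_add, hG.inv_mul hy] at h2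
      rw [mul_comm (1 / κ) κ, hc, one_smul] at h2
      rw [← h2]
      simp only [Matrix.mul_assoc]
    simp only [sub_mul, mul_sub, h1, Matrix.mul_smul, Matrix.smul_mul, Matrix.mul_one,
      Matrix.one_mul]
    ext i j
    simp only [Matrix.sub_apply, Matrix.smul_apply, Matrix.add_apply, smul_eq_mul]
    field_simp
    ring
  · intro q
    have h := hS.covMat_mul hy q
    have hNt : ((G y)⁻¹ * einsteinTensor G y - (1 / (2 * κ)) • (1 : Matrix (Fin 3) (Fin 3) ℝ))ᵀ =
        einsteinTensor G y * (G y)⁻¹ - (1 / (2 * κ)) • 1 := by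
      rw [Matrix.transpose_sub, Matrix.transpose_mul, hWs, hG.inv_symm hy, Matrix.transpose_smul,
        Matrix.transpose_one]
    rw [hNt]
    have h2 := congrArg (fun X => (1 / κ) • X) h
    simp only [smul_smul] at h2
    rw [mul_comm (1 / κ) κ, hc, one_smul] at h2
    simp only [sub_mul, mul_sub, Matrix.mul_smul, Matrix.smul_mul, Matrix.mul_one, Matrix.one_mul]
    rw [sub_add_sub_comm, h2, ← add_smul, ← sub_smul]
    have h0 : 1 / κ - (1 / (2 * κ) + 1 / (2 * κ)) = 0 := by field_simp; ring
    rw [h0, zero_smul]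

theorem frame_commute (hy : y ∈ U) (hA : IsFrame A (G y) (G y)⁻¹) (i j k l : Fin 3) :
    ∑ m, (fr4 A (fun i j k l => riem G i j k l y) i j k m *
      fr2 A (fun i j => einsteinTensor G y i j) m l +
      fr2 A (fun i j => einsteinTensor G y i j) k m *
      fr4 A (fun i j k l => riem G i j k l y) i j l m) = 0 := by
  have hG := hS.isMetricOn
  have hcomm := hG.curv_comm_of_parallel hG.smooth_einsteinTensor
    (fun z hz p => by
      have h := hS.covMat_eq_zero hz p
      rwa [covMat, sub_eq_zero] at h) hy
  -- Raising the last index rewrites the Ricci identity for the parallel tensor `W` with the fully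
  -- covariant curvature.
  have hup : ∀ i j m k, curv G i j y m k = ∑ n, riem G i j k n y * (G y)⁻¹ n m := by
    intro i j m k
    have h : (curv G i j y)ᵀ = ((curv G i j y)ᵀ * G y) * (G y)⁻¹ := by
      rw [Matrix.mul_assoc, hG.mul_inv hy, Matrix.mul_one]
    have h2 := congrFun (congrFun h k) m
    rw [Matrix.mul_apply] at h2
    simpa only [Matrix.transpose_apply, riem_eq_curv] using h2
  have h0 : ∀ i j k l, ∑ c, fr A (fun n => riem G i j k n y) c *
      fr A (fun m => einsteinTensor G y m l) c + ∑ c, fr A (fun n => riem G i j l n y) c *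
      fr A (fun m => einsteinTensor G y k m) c = 0 := by
    intro i j k l
    have h := congrFun (congrFun (hcomm i j) k) l
    rw [← hA.sum_inv_mul, ← hA.sum_inv_mul, ← Matrix.zero_apply k l, ← h]
    simp only [Matrix.add_apply, Matrix.mul_apply, Matrix.transpose_apply, hup, Fin.sum_univ_three]
    ring
  have h1 : fr4 A (fun i j k l => ∑ c, fr A (fun n => riem G i j k n y) c *
      fr A (fun m => einsteinTensor G y m l) c + ∑ c, fr A (fun n => riem G i j l n y) c *
      fr A (fun m => einsteinTensor G y k m) c) i j k l = 0 := by
    have e : (fun i j k l => ∑ c, fr A (fun n => riem G i j k n y) c *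
      fr A (fun m => einsteinTensor G y m l) c + ∑ c, fr A (fun n => riem G i j l n y) c *
      fr A (fun m => einsteinTensor G y k m) c) = fun _ _ _ _ => 0 := by
      funext i j k l; exact h0 i j k l
    rw [e]
    simp only [fr4, fr3, fr2, fr_zero]
  rw [← h1, Finset.sum_add_distrib]
  simp only [fr4, fr3, fr2, fr_add, fr_sum, fr_const_mul, fr_mul_const]
  congr 1
  · refine Finset.sum_congr rfl fun c _ => ?_
    congr 1
    exact fr_comm _ _ _
  · exact Finset.sum_congr rfl fun c _ => mul_comm _ _

/-- A soliton with harmonic curvature is hyperbolic. -/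
theorem exists_constant_curvature (hy : y ∈ U) : ∃ w, κ * w = 4 ∧ Real.exp (2 * f y) = 12 * w ∧
    ∀ i j, einsteinTensor G y i j = w * G y i j := by
  obtain ⟨A, hA⟩ := exists_isFrame (hS.isMetricOn.posDef y hy)
  have hc := hS.frame_commute hy hA
  rw [hA.riem_eq_ofEinstein hS.isMetricOn hy] at hc
  obtain ⟨h1, h2, -⟩ := hS.frame_einsteinTensor hy hA
  obtain ⟨w, hw1, hw2, hw3⟩ := einstein_of_commute
    (hA.fr2_einsteinTensor_symm hS.isMetricOn hy) (Real.exp_pos _) h1 h2 hc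
  refine ⟨w, hw1, hw2, ?_⟩
  have key : (fun i j => einsteinTensor G y i j) = fun i j => w * G y i j :=
    hA.fr2_injective fun a b => by
      rw [hw3, ← hA.fr2_metric_kd]
      simp only [fr2, fr_const_mul]
  exact fun i j => congrFun (congrFun key i) j

end IsLocalSoliton

end ConstantDilaton

/-! ### From charts to the manifold. -/

section Global

variable {M : Type*} [TopologicalSpace M] [ChartedSpace E3 M] [IsManifold 𝓘(ℝ, E3) ∞ M]
  {κ : ℝ} {g : Metric M} {φ : M → ℝ}

theorem IsTorsionlessSoliton.isLocalSoliton (hsol : IsTorsionlessSoliton κ g φ)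
    (hharm : HasHarmonicCurvature g) {e : OpenPartialHomeomorph M E3} (he : e ∈ charts M) :
    IsLocalSoliton κ (coordMetric g e) (φ ∘ e.symm) e.target where
  isMetricOn := ⟨e.open_target, contDiffOn_coordMetric g he,
    fun y _ => (coordMetric_isSymm g e y).eq, fun _ hy => coordMetric_posDef g he hy⟩
  smooth := contDiffOn_comp_symm hsol.smooth he
  einstein := hsol.einstein e he
  harmonic := hharm e he
  nullity y hy j k l := by
    have h := hsol.yangMills e he y hy j k l
    rwa [hharm e he y hy, zero_add] at h
  dilaton := hsol.dilaton e he

end Global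

end Heterotic

theorem mainTheorem3 {M : Type*} [TopologicalSpace M] [T2Space M] [CompactSpace M]
    [ChartedSpace Heterotic.E3 M] [IsManifold 𝓘(ℝ, Heterotic.E3) ∞ M]
    (κ : ℝ) (g : Heterotic.Metric M) (φ : M → ℝ)
    (hsol : Heterotic.IsTorsionlessSoliton κ g φ) (hflat : ¬ Heterotic.IsFlat g)
    (hharm : Heterotic.HasHarmonicCurvature g) :
    (∃ c : ℝ, ∀ x, φ x = c) ∧ Heterotic.IsHyperbolicSoliton κ g φ := by
  have hloc := fun e (he : e ∈ Heterotic.charts M) => hsol.isLocalSoliton hharm he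
  -- Non-flatness supplies a point, at which `κ |W|² = e^{2φ}` forces `κ > 0`.
  have hκ : 0 < κ := by
    simp only [Heterotic.IsFlat, not_forall] at hflat
    obtain ⟨e, he, y, hy, -⟩ := hflat
    exact (hloc e he).kappa_pos hy
  have hw : ∀ e (he : e ∈ Heterotic.charts M), ∀ y ∈ e.target,
      Real.exp (2 * φ (e.symm y)) = 48 / κ ∧ ∀ i j,
        Heterotic.einsteinTensor (Heterotic.coordMetric g e) y i j =
          4 / κ * Heterotic.coordMetric g e y i j := by
    intro e he y hy
    obtain ⟨w, h1, h2, h3⟩ := (hloc e he).exists_constant_curvature hy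
    have hw : w = 4 / κ := by rw [eq_div_iff hκ.ne']; linarith
    refine ⟨?_, by rw [← hw]; exact h3⟩
    have h4 : Real.exp (2 * φ (e.symm y)) = 12 * w := h2
    rw [h4, hw]; ring
  -- The value depends on `κ` alone, so `φ` is the same constant at every point, with no gluing
  -- between charts or components.
  have hE : ∀ x, Real.exp (2 * φ x) = 48 / κ := by
    intro x
    have h := (hw (chartAt Heterotic.E3 x) (IsManifold.chart_mem_maximalAtlas x) _
      (mem_chart_target Heterotic.E3 x)).1
    rwa [(chartAt Heterotic.E3 x).left_inv (mem_chart_source Heterotic.E3 x)] at h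
  have hconst : ∃ c : ℝ, ∀ x, φ x = c := by
    refine ⟨Real.log (48 / κ) / 2, fun x => ?_⟩
    rw [← hE x, Real.log_exp]; ring
  have hscal : ∀ e ∈ Heterotic.charts M, ∀ y ∈ e.target,
      Heterotic.scal (Heterotic.coordMetric g e) y = -24 / κ := by
    intro e he y hy
    have h := (hloc e he).scal_eq hy
    have h2 : Real.exp (2 * (φ ∘ e.symm) y) = 48 / κ := hE _
    rw [h, h2]; ring
  -- In dimension three the sectional curvature of a plane is minus the value of `W` on its unit
  -- normal, hence `K = -4/κ`.
  refine ⟨hconst, hsol, hconst, ⟨-4 / κ, div_neg_of_neg_of_pos (by norm_num) hκ, ?_⟩, ?_, ?_, ?_⟩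
  · intro e he y hy u v
    have h := fun i j k l => (hloc e he).riem_eq hy i j k l
    have h2 : Real.exp (2 * (φ ∘ e.symm) y) = 48 / κ := hE _
    have h3 : ∀ i j k l, Heterotic.riem (Heterotic.coordMetric g e) i j k l y =
        -4 / κ * (Heterotic.coordMetric g e y i l * Heterotic.coordMetric g e y j k -
          Heterotic.coordMetric g e y i k * Heterotic.coordMetric g e y j l) := by
      intro i j k l
      rw [h, h2]
      simp only [(hw e he y hy).2]
      ring
    have h4 : (∑ i, ∑ j, Heterotic.coordMetric g e y i j * (u i * v j)) ^ 2 =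
        (∑ i, ∑ k, Heterotic.coordMetric g e y i k * (u i * v k)) *
        ∑ j, ∑ l, Heterotic.coordMetric g e y j l * (v j * u l) := by
      rw [sq]
      congr 1
      rw [Finset.sum_comm]
      refine Finset.sum_congr rfl fun j _ => Finset.sum_congr rfl fun l _ => ?_
      rw [(hloc e he).isMetricOn.symm_apply hy l j, mul_comm (u l)]
    rw [h4]
    simp only [h3, Fin.sum_univ_three]
    ring
  · intro e he y hy i j
    have h := (hw e he y hy).2 i j
    simp only [Heterotic.einsteinTensor, Matrix.of_apply] at h
    rw [hscal e he y hy] at h ⊢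
    linear_combination h
  · intro e he y hy
    rw [hscal e he y hy]; field_simp
  · intro x
    rw [hE x]; field_simp
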